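/- Let $r,d\ge 1$ be integers, $b>0$, $C_f>0$, $\epsilon>0$, $0<\delta<1$. Let $\mathbf W\in\mathbb R^{r\times d}$ be a random matrix with i.i.d. entries from the Laplace distribution $\mathrm{Lap}(0,b)$, i.e. with density $x\mapsto\frac1{2b}e^{-|x|/b}$. Put $$C_w=4\Bigl(1+\frac{\log(2/\delta)}{\sqrt r+\sqrt d}\Bigr),\qquad \sigma^2=\frac{8\,C_w^2\,b^2\,C_f^2\,(r+d)\,\log(1.25/\delta)}{\epsilon^2},\qquad D=C_f\,C_w\,b\,(\sqrt r+\sqrt d).$$ For a fixed matrix $\mathbf W$, let $\mathcal M_{\mathbf W}(\mathbf f)=\mathbf W\mathbf f+\mathbf n$ with $\mathbf n\sim\mathcal N(\mathbf 0,\sigma^2\mathbf I_r)$, for clipped features $\mathbf f\in\mathbb R^d$, $\|\mathbf f\|_2\le C_f$. A mechanism $\mathcal M$ on this ball is $(\epsilon,\delta')$-feature DP if for all $\mathbf f,\mathbf f'$ in the ball with $\|\mathbf f-\mathbf f'\|_2\le 2C_f$ and all measurable $S\subseteq\mathbb R^r$, $\Pr(\mathcal M(\mathbf f)\in S)\le e^{\epsilon}\Pr(\mathcal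 M(\mathbf f')\in S)+\delta'$. (a) With probability at least $1-\delta$ over the draw of $\mathbf W$, the following hold together: the spectral norm satisfies $\|\mathbf W\|_2\le C_w\,b\,(\sqrt r+\sqrt d)$; consequently $\|\mathbf W\mathbf f\|_2\le D$ for every clipped feature $\mathbf f$; and, if $\epsilon\le 1$, the mechanism $\mathcal M_{\mathbf W}$ is $(\epsilon,2\delta)$-feature DP. (b) Let $g\in\mathbb R$, $\alpha>0$, $\sigma_a\ge 0$ and $\nu^2=g^2\alpha^2\sigma^2+\sigma_a^2$. An adversary observes $\mathbf y_{\mathrm{adv}}=g\alpha\mathbf z+g\alpha\mathbf n+\mathbf m_{\mathrm{adv}}$, where $\mathbf n\sim\mathcal N(\mathbf 0,\sigma^2\mathbf I_r)$ and $\mathbf m_{\mathrm{adv}}\sim\mathcal N(\mathbf 0,\sigma_a^2\mathbf I_r)$ are independent, and estimates the code $\mathbf z\in\mathbb R^r$ by $\hat{\mathbf z}=\gamma\,\mathbf y_{\mathrm{adv}}$. The minimax error over linear rescalings $$\mathrm{MSE}_{\mathrm{adv}}=\inf_{\gamma\in\mathbb R}\ \sup_{\|\mathbf z\|_2\le D}\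 \mathbb E\bigl[\|\gamma\,\mathbf y_{\mathrm{adv}}-\mathbf z\|_2^2\bigr]$$ satisfies $$\mathrm{MSE}_{\mathrm{adv}}\ \ge\ \frac{r\,\nu^2D^2}{g^2\alpha^2D^2+r\,\nu^2},$$ where the right-hand side is read as $0$ if its denominator vanishes (i.e. if $g=\sigma_a=0$). -/

import Mathlib

open MeasureTheory ProbabilityTheory
open scoped ENNReal

namespace FeaturePrivacy

noncomputable section

/-- The Laplace distribution `Lap(μ, b)` on `ℝ` (location `μ`, scale `b > 0`), with density
`x ↦ exp (-|x - μ| / b) / (2 b)` with respect to Lebesgue measure. -/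
def laplaceMeasure (μ b : ℝ) : Measure ℝ :=
  volume.withDensity fun x => ENNReal.ofReal (Real.exp (-|x - μ| / b) / (2 * b))

/-- The isotropic centred Gaussian distribution `N(0, σ² I_n)` on Euclidean space `ℝⁿ`. -/
def isoGaussian (n : ℕ) (σ : ℝ) : Measure (EuclideanSpace ℝ (Fin n)) :=
  multivariateGaussian 0 (σ ^ 2 • (1 : Matrix (Fin n) (Fin n) ℝ))

/-- The code `W f ∈ ℝʳ` of a feature vector `f ∈ ℝᵈ`. -/
def encode {r d : ℕ} (W : Matrix (Fin r) (Fin d) ℝ) (f : EuclideanSpace ℝ (Fin d)) :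
    EuclideanSpace ℝ (Fin r) :=
  WithLp.toLp 2 (W.mulVec f.ofLp)

/-- The spectral norm of a real matrix: the operator norm of `f ↦ W f` for the Euclidean norms. -/
def specNorm {r d : ℕ} (W : Matrix (Fin r) (Fin d) ℝ) : ℝ :=
  ‖(Matrix.toEuclideanLin W).toContinuousLinearMap‖

/-- The mechanism `f ↦ W f + n`, `n ∼ N(0, σ² I_r)`, for a fixed matrix `W`; a feature is sent to
the distribution of the output. -/
def gaussianMechanism {r d : ℕ} (W : Matrix (Fin r) (Fin d) ℝ) (σ : ℝ)
    (f : EuclideanSpace ℝ (Fin d)) : Measure (EuclideanSpace ℝ (Fin r)) :=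
  (isoGaussian r σ).map fun n => encode W f + n

/-- `(ε, δ)`-feature differential privacy of a randomized mechanism `M` (given by the distributions
of its outputs) on the feature space `F`, where features at distance at most `2 C` are
neighbours. -/
def FeatureDP {r d : ℕ} (F : Set (EuclideanSpace ℝ (Fin d))) (C ε δ : ℝ)
    (M : EuclideanSpace ℝ (Fin d) → Measure (EuclideanSpace ℝ (Fin r))) : Prop :=
  ∀ f ∈ F, ∀ f' ∈ F, ‖f - f'‖ ≤ 2 * C →
    ∀ S : Set (EuclideanSpace ℝ (Fin r)), MeasurableSet S →
      M f S ≤ ENNReal.ofReal (Real.exp ε) * M f' S + ENNReal.ofReal δ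

/-- The adversary's observation `y = g α z + g α n + m` of the code `z`, where `n` is the privacy
noise and `m` the noise of the adversary's receiver. -/
def advObservation {r : ℕ} (g α : ℝ) (z n m : EuclideanSpace ℝ (Fin r)) :
    EuclideanSpace ℝ (Fin r) :=
  (g * α) • z + (g * α) • n + m

/-- The mean squared error `E ‖γ y - z‖²` at `z` of the linear estimator `γ y`, where
`y = g α z + g α n + m` with independent `n ∼ N(0, σ² I_r)` and `m ∼ N(0, σa² I_r)`. -/
def advMSE (r : ℕ) (g α σ σa γ : ℝ) (z : EuclideanSpace ℝ (Fin r)) : ℝ≥0∞ :=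
  ∫⁻ p : EuclideanSpace ℝ (Fin r) × EuclideanSpace ℝ (Fin r),
    ENNReal.ofReal (‖γ • advObservation g α z p.1 p.2 - z‖ ^ 2)
      ∂((isoGaussian r σ).prod (isoGaussian r σa))

/-- The minimax mean squared error over linear estimators `γ y`, `γ ∈ ℝ`, and codes `z` with
`‖z‖ ≤ D`. -/
def minimaxAdvMSE (r : ℕ) (g α σ σa D : ℝ) : ℝ≥0∞ :=
  ⨅ γ : ℝ, ⨆ z ∈ Metric.closedBall (0 : EuclideanSpace ℝ (Fin r)) D, advMSE r g α σ σa γ z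

end

end FeaturePrivacy

/-!
The proof has one substantial ingredient, a tail bound with explicit constants for the spectral
norm of a matrix of independent Laplace entries (`measure_l2_opNorm_gt_le`); the rest is the
Gaussian mechanism and a bias-variance computation.

*Spectral norm.* Let `eₙ` be the orthonormal polynomials of the Laplace distribution of scale `b`.
Its density being even, they satisfy `x eₙ = αₙ₊₁ eₙ₊₁ + αₙ eₙ₋₁`, and a Cauchy-Schwarz inequality
with the weight `|x|`, together with integration by parts, gives `αₙ² ≤ b² (4 n² - 1)`
(`map_orthPoly_succ_le`). The products `∏ e_{n p} (W p)` over the entries are orthonormal, and in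
this system multiplication by `W` is the sum of a part that raises the degree and a part that lowers
it. Schur's test bounds both on polynomials of degree `m` (`CoeffGrowth.exists_mul_coeff`): the sum
of the second moments of the coordinates of `W f` exceeds that of `f` by a factor of at most
`4 b² (r + d + (2 m + 2)²)`. Iterating this over the alternating products `1, W, WᵀW, WWᵀW, …`,
whose Hilbert-Schmidt norms dominate the powers of the spectral norm, yields
`E ‖W‖ ^ (2 k) ≤ min r d * (4 b²) ^ k * ∏_{m < k} (r + d + (2 m + 2)²)`
(`integral_altPowSq_le`, `l2_opNorm_pow_le_altPowSq`). These products are the Taylor coefficients of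
the second derivative of `cosh (√(r + d) arcsin x)`, up to the factor `r + d`, so the series for
`E cosh (‖W‖ / (√8 b))` is bounded by its value at `x = 1 / √2`, hence by `exp (√r + √d + 1 / 2)`
(`sum_prod_div_factorial_le`, `mul_cosh_le_exp`). Markov's inequality shows that
`‖W‖ ≤ √8 b (√r + √d + log (2 / δ) + 1 / 2)` outside an event of probability `δ`.

*Privacy.* That threshold is smaller than `C_w b (√r + √d) = 4 b (√r + √d + log (2 / δ))` by a
factor that approaches `√2`, and this is what the privacy claim rests on: on the larger event the
prescribed `σ²` can be as little as half of what the usual analysis of the Gaussian mechanism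
requires, because `r + d` may be only half of `(√r + √d)²`. On the smaller event the
Cameron-Martin formula reduces the claim to the tail of a one-dimensional Gaussian variable
(`isoGaussian_map_add_apply_le`). Keeping the factor `1 / 2` in the Gaussian tail bound, one gets a
failure probability of at most `exp (3 / 2) / 2.5 * δ`, which is at most `2 δ`.

*Adversary.* The error at `z` is `(γ g α - 1)² ‖z‖² + γ² r ν²` (`advMSE_eq`), and its minimum over
`γ` at `‖z‖ = D` is the stated bound.
-/

namespace FeaturePrivacy

/-! ### The Taylor series of `cosh (w arcsin x)` -/

/-- Taylor's inequality for an absolutely monotone function: if all derivatives `F n` of `F 0` are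
nonnegative on `[0, X]`, then every Taylor polynomial at `0` is a lower bound. -/
lemma sum_taylor_le_of_derivs_nonneg (X : ℝ) (N : ℕ) (F : ℕ → ℝ → ℝ)
    (hF : ∀ n, ∀ x ∈ Set.Icc 0 X, HasDerivAt (F n) (F (n + 1) x) x)
    (hpos : ∀ n, ∀ x ∈ Set.Icc 0 X, 0 ≤ F n x) :
    ∀ x ∈ Set.Icc 0 X, ∑ n ∈ Finset.range N, F n 0 * x ^ n / (n.factorial : ℝ) ≤ F 0 x := by
  induction N generalizing F with
  | zero => intro x hx; simpa using hpos 0 x hx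
  | succ N ih =>
    have ih' := ih (fun n => F (n + 1)) (fun n => hF (n + 1)) (fun n => hpos (n + 1))
    let G : ℝ → ℝ := fun x => F 0 x - ∑ n ∈ Finset.range (N + 1), F n 0 * x ^ n / (n.factorial : ℝ)
    have hG : ∀ x ∈ Set.Icc 0 X, HasDerivAt G
        (F 1 x - ∑ n ∈ Finset.range N, F (n + 1) 0 * x ^ n / (n.factorial : ℝ)) x := by
      intro x hx
      refine (hF 0 x hx).sub ?_
      have h : ∀ n ∈ Finset.range (N + 1),
          HasDerivAt (fun x : ℝ => F n 0 * x ^ n / (n.factorial : ℝ))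
            (F n 0 * ((n : ℝ) * x ^ (n - 1)) / (n.factorial : ℝ)) x := fun n _ =>
        ((hasDerivAt_pow n x).const_mul _).div_const _
      refine (HasDerivAt.fun_sum h).congr_deriv ?_
      rw [Finset.sum_range_succ']
      simp only [Nat.cast_zero, zero_mul, mul_zero, zero_div, add_zero]
      refine Finset.sum_congr rfl fun n _ => ?_
      rw [Nat.factorial_succ]
      push_cast
      have : ((n.factorial : ℕ) : ℝ) ≠ 0 := by positivity
      field_simp
    have hmono : MonotoneOn G (Set.Icc 0 X) := by
      refine monotoneOn_of_deriv_nonneg (convex_Icc 0 X)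
        (fun x hx => (hG x hx).continuousAt.continuousWithinAt)
        (fun x hx => ((hG x (interior_subset hx)).differentiableAt).differentiableWithinAt) ?_
      intro x hx
      rw [(hG x (interior_subset hx)).deriv]
      exact sub_nonneg.2 (ih' x (interior_subset hx))
    intro x hx
    have h0 : G 0 ≤ G x := hmono ⟨le_rfl, hx.1.trans hx.2⟩ hx hx.1
    have hG0 : G 0 = 0 := by
      simp only [G]
      rw [Finset.sum_range_succ']
      simp
    rw [hG0] at h0
    exact sub_nonneg.1 h0

/-- The iterated derivatives of `x ↦ cosh (w arcsin x)`, by the recursion that the differential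
equation `(1 - x²) f'' - x f' = w² f` gives. -/
noncomputable def coshArcsinDeriv (w : ℝ) : ℕ → ℝ → ℝ
  | 0 => fun x => Real.cosh (w * Real.arcsin x)
  | 1 => fun x => w * Real.sinh (w * Real.arcsin x) / √(1 - x ^ 2)
  | n + 2 => fun x => ((2 * n + 1) * x * coshArcsinDeriv w (n + 1) x
      + (n ^ 2 + w ^ 2) * coshArcsinDeriv w n x) / (1 - x ^ 2)

lemma hasDerivAt_coshArcsinDeriv (w : ℝ) (n : ℕ) {x : ℝ} (h0 : -1 < x) (h1 : x < 1) :
    HasDerivAt (coshArcsinDeriv w n) (coshArcsinDeriv w (n + 1) x) x := by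
  have hx : 0 < 1 - x ^ 2 := by nlinarith
  have hs : 0 < √(1 - x ^ 2) := Real.sqrt_pos.2 hx
  have hs2 : √(1 - x ^ 2) ^ 2 = 1 - x ^ 2 := Real.sq_sqrt hx.le
  have harc : HasDerivAt (fun x => w * Real.arcsin x) (w * (1 / √(1 - x ^ 2))) x :=
    (Real.hasDerivAt_arcsin h0.ne' h1.ne).const_mul w
  have hden : HasDerivAt (fun x : ℝ => 1 - x ^ 2) (-(2 * x)) x := by
    simpa using (hasDerivAt_pow 2 x).const_sub 1
  have key : ∀ n, HasDerivAt (coshArcsinDeriv w n) (coshArcsinDeriv w (n + 1) x) x ∧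
      HasDerivAt (coshArcsinDeriv w (n + 1)) (coshArcsinDeriv w (n + 2) x) x := by
    intro n
    induction n with
    | zero =>
      constructor
      · refine (harc.cosh).congr_deriv ?_
        simp only [coshArcsinDeriv]
        ring
      · have := ((harc.sinh).const_mul w).div (hden.sqrt hx.ne') hs.ne'
        refine this.congr_deriv ?_
        simp only [coshArcsinDeriv]
        rw [hs2]
        field_simp
        push_cast
        ring
    | succ n ih =>
      refine ⟨ih.2, ?_⟩
      have hid : HasDerivAt (fun x : ℝ => (2 * (n : ℝ) + 1) * x) (2 * (n : ℝ) + 1) x := by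
        simpa using (hasDerivAt_id x).const_mul (2 * (n : ℝ) + 1)
      have := ((hid.mul ih.2).add (ih.1.const_mul ((n : ℝ) ^ 2 + w ^ 2))).div hden hx.ne'
      refine (HasDerivAt.congr_deriv this ?_)
      have e3 : coshArcsinDeriv w (n + 1 + 2) x = ((2 * ((n + 1 : ℕ) : ℝ) + 1) * x *
        coshArcsinDeriv w (n + 2) x + (((n + 1 : ℕ) : ℝ) ^ 2 + w ^ 2) * coshArcsinDeriv w (n + 1) x)
          / (1 - x ^ 2) := rfl
      have e2 : coshArcsinDeriv w (n + 2) x * (1 - x ^ 2) = (2 * (n : ℝ) + 1) * x *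
        coshArcsinDeriv w (n + 1) x + ((n : ℝ) ^ 2 + w ^ 2) * coshArcsinDeriv w n x := by
        rw [coshArcsinDeriv, div_mul_cancel₀ _ hx.ne']
      rw [e3]
      simp only [Pi.add_apply, Pi.mul_apply]
      rw [← e2]
      push_cast
      field_simp
      ring
  exact (key n).1

lemma coshArcsinDeriv_nonneg {w : ℝ} (hw : 0 ≤ w) (n : ℕ) {x : ℝ} (h0 : 0 ≤ x) (h1 : x < 1) :
    0 ≤ coshArcsinDeriv w n x := by
  have hx : 0 < 1 - x ^ 2 := by nlinarith
  have harc : 0 ≤ w * Real.arcsin x := mul_nonneg hw (Real.arcsin_nonneg.2 h0)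
  have key : ∀ n, 0 ≤ coshArcsinDeriv w n x ∧ 0 ≤ coshArcsinDeriv w (n + 1) x := by
    intro n
    induction n with
    | zero =>
      refine ⟨(Real.cosh_pos _).le, ?_⟩
      have : 0 ≤ Real.sinh (w * Real.arcsin x) := Real.sinh_nonneg_iff.2 harc
      simp only [coshArcsinDeriv]
      positivity
    | succ n ih =>
      refine ⟨ih.2, ?_⟩
      have := ih.1
      have := ih.2
      simp only [coshArcsinDeriv]
      positivity
  exact (key n).1

lemma coshArcsinDeriv_even_zero (w : ℝ) (k : ℕ) :
    coshArcsinDeriv w (2 * k + 2) 0 =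
      w ^ 2 * ∏ m ∈ Finset.range k, (w ^ 2 + (2 * (m : ℝ) + 2) ^ 2) := by
  induction k with
  | zero => simp [coshArcsinDeriv]
  | succ k ih =>
    rw [Finset.prod_range_succ, ← mul_assoc, ← ih]
    rw [show 2 * (k + 1) + 2 = (2 * k + 2) + 2 by ring]
    rw [coshArcsinDeriv]
    push_cast
    ring

lemma sinh_le_mul_cosh {y : ℝ} (hy : 0 ≤ y) : Real.sinh y ≤ y * Real.cosh y := by
  have hd : ∀ x, HasDerivAt (fun x => x * Real.cosh x - Real.sinh x) (x * Real.sinh x) x := by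
    intro x
    refine (((hasDerivAt_id x).mul (Real.hasDerivAt_cosh x)).sub
      (Real.hasDerivAt_sinh x)).congr_deriv ?_
    simp
  have hmono : MonotoneOn (fun x => x * Real.cosh x - Real.sinh x) (Set.Ici 0) := by
    refine monotoneOn_of_deriv_nonneg (convex_Ici 0)
      (fun x _ => (hd x).continuousAt.continuousWithinAt)
      (fun x _ => (hd x).differentiableAt.differentiableWithinAt) ?_
    intro x hx
    rw [(hd x).deriv]
    have hx0 : 0 ≤ x := interior_subset hx
    exact mul_nonneg hx0 (Real.sinh_nonneg_iff.2 hx0)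
  have := hmono (Set.mem_Ici.2 le_rfl) (Set.mem_Ici.2 hy) hy
  simp only [zero_mul, Real.sinh_zero, sub_zero] at this
  linarith

/-- The series is that of the second derivative of `cosh (w arcsin x)` at `x = 1 / √2`, where
`w = √s`. -/
lemma sum_prod_div_factorial_le {s : ℝ} (hs : 0 < s) (K : ℕ) :
    ∑ k ∈ Finset.range K, (∏ m ∈ Finset.range k, (s + (2 * (m : ℝ) + 2) ^ 2)) /
      (2 ^ k * ((2 * k).factorial : ℝ)) ≤
      (2 + Real.pi / 2) * Real.cosh (√s * (Real.pi / 4)) := by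
  set w := √s with hw
  have hw0 : 0 < w := Real.sqrt_pos.2 hs
  have hw2 : w ^ 2 = s := Real.sq_sqrt hs.le
  set X : ℝ := √2 / 2 with hX
  have h2 : √2 ^ 2 = (2 : ℝ) := Real.sq_sqrt (by norm_num)
  have hX0 : 0 ≤ X := by positivity
  have hX2 : X ^ 2 = 1 / 2 := by rw [hX, div_pow, h2]; norm_num
  have hX1 : X < 1 := by nlinarith
  have htay := sum_taylor_le_of_derivs_nonneg X (2 * K) (fun n => coshArcsinDeriv w (n + 2))
    (fun n x hx => hasDerivAt_coshArcsinDeriv w (n + 2) (by linarith [hx.1]) (by linarith [hx.2]))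
    (fun n x hx => coshArcsinDeriv_nonneg hw0.le (n + 2) hx.1 (by linarith [hx.2])) X
    ⟨hX0, le_rfl⟩
  have hval : coshArcsinDeriv w 2 X = 2 * w ^ 2 * Real.cosh (w * (Real.pi / 4)) +
      2 * w * Real.sinh (w * (Real.pi / 4)) := by
    have harc : Real.arcsin X = Real.pi / 4 := by
      rw [hX, ← Real.sin_pi_div_four]
      exact Real.arcsin_sin (by linarith [Real.pi_pos]) (by linarith [Real.pi_pos])
    have hsq : √(1 - X ^ 2) = X := by
      rw [show 1 - X ^ 2 = X ^ 2 by rw [hX2]; norm_num, Real.sqrt_sq hX0]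
    have hXp : X ≠ 0 := by intro h; rw [h] at hX2; norm_num at hX2
    simp only [coshArcsinDeriv]
    rw [hsq, harc, show 1 - X ^ 2 = 1 / 2 by rw [hX2]; norm_num]
    field_simp
    push_cast
    ring
  have hsub : ∑ k ∈ Finset.range K, s * ((∏ m ∈ Finset.range k, (s + (2 * (m : ℝ) + 2) ^ 2)) /
      (2 ^ k * ((2 * k).factorial : ℝ))) ≤ coshArcsinDeriv w 2 X := by
    refine le_trans ?_ htay
    have hinj : Set.InjOn (fun k : ℕ => 2 * k) (Finset.range K) := by
      intro a _ b _ h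
      simpa using h
    have himg : (Finset.range K).image (fun k => 2 * k) ⊆ Finset.range (2 * K) := by
      intro n hn
      obtain ⟨k, hk, rfl⟩ := Finset.mem_image.1 hn
      have := Finset.mem_range.1 hk
      exact Finset.mem_range.2 (by omega)
    refine le_trans (le_of_eq ?_) (Finset.sum_le_sum_of_subset_of_nonneg himg fun n _ _ => ?_)
    · rw [Finset.sum_image hinj]
      refine Finset.sum_congr rfl fun k _ => ?_
      rw [coshArcsinDeriv_even_zero, hw2, pow_mul, hX2]
      have : ((2 * k).factorial : ℝ) ≠ 0 := by positivity
      rw [one_div, inv_pow]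
      field_simp
    · have := coshArcsinDeriv_nonneg hw0.le (n + 2) le_rfl (by norm_num : (0 : ℝ) < 1)
      positivity
  rw [← Finset.mul_sum, hval] at hsub
  have hsinh : Real.sinh (w * (Real.pi / 4)) ≤
      w * (Real.pi / 4) * Real.cosh (w * (Real.pi / 4)) := sinh_le_mul_cosh (by positivity)
  have hfin : 2 * w ^ 2 * Real.cosh (w * (Real.pi / 4)) + 2 * w * Real.sinh (w * (Real.pi / 4)) ≤
      s * ((2 + Real.pi / 2) * Real.cosh (w * (Real.pi / 4))) := by
    have := mul_le_mul_of_nonneg_left hsinh (by positivity : 0 ≤ 2 * w)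
    rw [← hw2]
    linarith
  exact le_of_mul_le_mul_left (hsub.trans hfin) hs

/-! ### A numerical inequality for the exponential moment -/

/-- `d ≤ r` is essential: the left side carries the smaller dimension only. -/
lemma mul_cosh_le_exp {r d : ℝ} (hd : 1 ≤ d) (hdr : d ≤ r) :
    d * ((2 + Real.pi / 2) * Real.cosh (√(r + d) * (Real.pi / 4))) ≤
      Real.exp (√r + √d + 1 / 2) := by
  set a := √d with ha
  set x := √r with hx
  have ha2 : a ^ 2 = d := Real.sq_sqrt (by linarith)
  have hx2 : x ^ 2 = r := Real.sq_sqrt (by linarith)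
  have ha1 : 1 ≤ a := Real.one_le_sqrt.2 hd
  have hax : a ≤ x := Real.sqrt_le_sqrt hdr
  have hpi := Real.pi_lt_d4
  have hpi3 := Real.pi_gt_three
  set y := √(r + d) * (Real.pi / 4) with hy
  -- `√(r + d) ≤ √r + (√2 - 1) √d`, since `√d ≤ √r`
  have hsq : √(r + d) ≤ x + 0.4143 * a := by
    apply Real.sqrt_le_iff.2
    constructor
    · positivity
    · rw [← ha2, ← hx2]; nlinarith
  have hy1 : y ≤ 0.78540 * x + 0.3254 * a := by
    have h0 : 0 ≤ x + 0.4143 * a := by positivity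
    calc y ≤ (x + 0.4143 * a) * (Real.pi / 4) := by
          rw [hy]; exact mul_le_mul_of_nonneg_right hsq (by positivity)
      _ ≤ (x + 0.4143 * a) * (3.1416 / 4) := by
          apply mul_le_mul_of_nonneg_left _ h0; linarith
      _ ≤ _ := by linarith
  have hy0 : 1 ≤ y := by
    have h14 : (1.4 : ℝ) ≤ √(r + d) := by
      apply Real.le_sqrt_of_sq_le; norm_num; linarith
    nlinarith
  -- the constant `0.2` bounds `exp (-2)`
  have he2 : Real.exp (-y) ≤ 0.2 * Real.exp y := by
    have h1 : Real.exp (-y) * Real.exp y = 1 := by rw [← Real.exp_add]; simp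
    have h2 : 2.7182818283 < Real.exp y := by
      have := Real.exp_one_gt_d9
      have := Real.exp_le_exp.2 hy0
      linarith
    have h3 : 0 < Real.exp (-y) := Real.exp_pos _
    nlinarith
  have hcosh : Real.cosh y ≤ 0.6 * Real.exp y := by rw [Real.cosh_eq]; linarith
  -- `a² ≤ (2 / 0.889)² exp (0.889 a - 2)`, from `u ≤ exp (u - 1)` at `u = 0.889 a / 2`
  have hquad : a ^ 2 ≤ 5.07 * Real.exp (0.889 * a - 2) := by
    have h1 : 0.4445 * a ≤ Real.exp (0.4445 * a - 1) := by
      have := Real.add_one_le_exp (0.4445 * a - 1); linarith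
    have h2 : Real.exp (0.889 * a - 2) = Real.exp (0.4445 * a - 1) ^ 2 := by
      rw [← Real.exp_nat_mul]; congr 1; push_cast; ring
    rw [h2]
    have : (0.4445 * a) ^ 2 ≤ Real.exp (0.4445 * a - 1) ^ 2 :=
      pow_le_pow_left₀ (by positivity) h1 2
    nlinarith
  have hconst : (2 + Real.pi / 2) * 0.6 ≤ 2.15 := by linarith
  have he : 11 * Real.exp (-(5 / 2)) ≤ 1 := by
    have h1 : Real.exp (5 / 2) * Real.exp (-(5 / 2)) = 1 := by rw [← Real.exp_add]; simp
    have h2 : (11 : ℝ) ≤ Real.exp (5 / 2) := by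
      have h4 : Real.exp (5 / 2) ^ 2 = Real.exp 1 ^ 5 := by
        rw [← Real.exp_nat_mul, ← Real.exp_nat_mul]; congr 1; norm_num
      have h5 : (2.7182818283 : ℝ) ^ 5 ≤ Real.exp 1 ^ 5 :=
        pow_le_pow_left₀ (by norm_num) Real.exp_one_gt_d9.le 5
      have h6 : (11 : ℝ) ^ 2 ≤ Real.exp (5 / 2) ^ 2 := by
        rw [h4]; refine le_trans ?_ h5; norm_num
      exact (pow_le_pow_iff_left₀ (by norm_num) (Real.exp_pos _).le two_ne_zero).1 h6
    nlinarith [Real.exp_pos (-(5 / 2 : ℝ))]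
  calc d * ((2 + Real.pi / 2) * Real.cosh y)
      ≤ d * ((2 + Real.pi / 2) * (0.6 * Real.exp y)) := by gcongr
    _ = ((2 + Real.pi / 2) * 0.6) * a ^ 2 * Real.exp y := by rw [ha2]; ring
    _ ≤ 2.15 * (5.07 * Real.exp (0.889 * a - 2)) * Real.exp y := by gcongr
    _ ≤ 11 * Real.exp (0.889 * a - 2) * Real.exp y := by
        have := mul_pos (Real.exp_pos (0.889 * a - 2)) (Real.exp_pos y)
        nlinarith
    _ = 11 * Real.exp (-(5 / 2)) * Real.exp (0.889 * a + y + 1 / 2) := by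
        rw [mul_assoc, mul_assoc, ← Real.exp_add, ← Real.exp_add]; congr 2; ring
    _ ≤ 1 * Real.exp (x + a + 1 / 2) := by
        refine mul_le_mul he (Real.exp_le_exp.2 ?_) (Real.exp_pos _).le zero_le_one
        -- the exponents balance at `x = a`: `0.889 + 0.7854 + 0.3254 ≤ 2`
        linarith
    _ = _ := one_mul _


/-! ### Orthogonal polynomials of a symmetric positive functional -/

section OrthogonalPolynomials

open Polynomial

/-- The monic orthogonal polynomials of a positive functional `φ` all of whose odd moments vanish,
by their three-term recursion (which then has no middle term). -/
noncomputable def orthPoly (φ : ℝ[X] →ₗ[ℝ] ℝ) : ℕ → ℝ[X]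
  | 0 => 1
  | 1 => X
  | n + 2 => X * orthPoly φ (n + 1) -
      C (φ (orthPoly φ (n + 1) * orthPoly φ (n + 1)) / φ (orthPoly φ n * orthPoly φ n)) *
        orthPoly φ n

variable {φ : ℝ[X] →ₗ[ℝ] ℝ}

lemma orthPoly_monic_degree (φ : ℝ[X] →ₗ[ℝ] ℝ) (n : ℕ) :
    (orthPoly φ n).Monic ∧ (orthPoly φ n).degree = n := by
  have key : ∀ n, ((orthPoly φ n).Monic ∧ (orthPoly φ n).degree = n) ∧
      ((orthPoly φ (n + 1)).Monic ∧ (orthPoly φ (n + 1)).degree = (n + 1 : ℕ)) := by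
    intro n
    induction n with
    | zero => simp [orthPoly, monic_X]
    | succ n ih =>
      refine ⟨ih.2, ?_⟩
      obtain ⟨⟨h1, h2⟩, h3, h4⟩ := ih
      have hmon : (X * orthPoly φ (n + 1)).Monic := monic_X.mul h3
      have hdeg : (X * orthPoly φ (n + 1)).degree = ((n + 2 : ℕ) : WithBot ℕ) := by
        rw [degree_mul, degree_X, h4]; norm_cast; ring
      have hlt : (C (φ (orthPoly φ (n + 1) * orthPoly φ (n + 1)) /
          φ (orthPoly φ n * orthPoly φ n)) * orthPoly φ n).degree <
          (X * orthPoly φ (n + 1)).degree := by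
        refine lt_of_le_of_lt ((degree_mul_le _ _).trans (add_le_add_left degree_C_le _)) ?_
        rw [hdeg, h2, zero_add]
        exact_mod_cast (by omega : n < n + 2)
      exact ⟨hmon.sub_of_left hlt, (degree_sub_eq_left_of_degree_lt hlt).trans hdeg⟩
  exact (key n).1

lemma orthPoly_comp_neg_X (φ : ℝ[X] →ₗ[ℝ] ℝ) (n : ℕ) :
    (orthPoly φ n).comp (-X) = (-1) ^ n * orthPoly φ n := by
  have key : ∀ n, (orthPoly φ n).comp (-X) = (-1) ^ n * orthPoly φ n ∧
      (orthPoly φ (n + 1)).comp (-X) = (-1) ^ (n + 1) * orthPoly φ (n + 1) := by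
    intro n
    induction n with
    | zero => simp [orthPoly]
    | succ n ih =>
      refine ⟨ih.2, ?_⟩
      rw [orthPoly, sub_comp, mul_comp, mul_comp, ih.1, ih.2, X_comp, C_comp]
      ring
  exact (key n).1

lemma orthPoly_ne_zero (φ : ℝ[X] →ₗ[ℝ] ℝ) (n : ℕ) : orthPoly φ n ≠ 0 :=
  (orthPoly_monic_degree φ n).1.ne_zero

lemma natDegree_orthPoly (φ : ℝ[X] →ₗ[ℝ] ℝ) (n : ℕ) : (orthPoly φ n).natDegree = n :=
  natDegree_eq_of_degree_eq_some (orthPoly_monic_degree φ n).2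

lemma X_mul_orthPoly (φ : ℝ[X] →ₗ[ℝ] ℝ) (n : ℕ) :
    X * orthPoly φ (n + 1) = orthPoly φ (n + 2) +
      C (φ (orthPoly φ (n + 1) * orthPoly φ (n + 1)) / φ (orthPoly φ n * orthPoly φ n)) *
        orthPoly φ n := by
  rw [orthPoly]; ring

lemma map_C_mul (φ : ℝ[X] →ₗ[ℝ] ℝ) (c : ℝ) (p : ℝ[X]) : φ (C c * p) = c * φ p := by
  rw [← smul_eq_C_mul, map_smul, smul_eq_mul]

lemma map_eq_zero_of_comp_neg (hsym : ∀ p, φ (p.comp (-X)) = φ p) {p : ℝ[X]}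
    (hp : p.comp (-X) = -p) : φ p = 0 := by
  have := hsym p
  rw [hp, map_neg] at this
  linarith

/-- A functional that kills `p * X ^ k` for `k < m` kills `p * q` whenever `deg q < m`. -/
lemma map_mul_eq_zero_of_degree_lt {p : ℝ[X]} {m : ℕ} (h : ∀ k < m, φ (p * X ^ k) = 0)
    {q : ℝ[X]} (hq : q.degree < m) : φ (p * q) = 0 := by
  rcases eq_or_ne q 0 with rfl | hq0
  · simp
  have hlt : q.natDegree < m := (natDegree_lt_iff_degree_lt hq0).2 hq
  rw [q.as_sum_range_C_mul_X_pow, Finset.mul_sum, map_sum]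
  refine Finset.sum_eq_zero fun k hk => ?_
  have hk' : k < m := lt_of_le_of_lt (Nat.lt_succ_iff.1 (Finset.mem_range.1 hk)) hlt
  rw [mul_left_comm, map_C_mul, h k hk', mul_zero]

lemma degree_sub_lt_of_monic {p q : ℝ[X]} {m : ℕ} (hp : p.Monic) (hpd : p.degree = m)
    (hq : q.Monic) (hqd : q.degree = m) : (p - q).degree < m := by
  rw [← hpd]
  exact degree_sub_lt_left (hpd.trans hqd.symm) hp.ne_zero (by rw [hp.leadingCoeff, hq.leadingCoeff])

/-- Against a polynomial orthogonal to everything of lower degree, all monic polynomials of the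
same degree have the same pairing. -/
lemma map_mul_eq_of_monic {p : ℝ[X]} {m : ℕ} (h : ∀ k < m, φ (p * X ^ k) = 0) {q q' : ℝ[X]}
    (hq : q.Monic) (hqd : q.degree = m) (hq' : q'.Monic) (hqd' : q'.degree = m) :
    φ (p * q) = φ (p * q') := by
  have := map_mul_eq_zero_of_degree_lt h (degree_sub_lt_of_monic hq hqd hq' hqd')
  rw [mul_sub, map_sub] at this
  linarith

lemma map_orthPoly_mul_X_pow (hsym : ∀ p, φ (p.comp (-X)) = φ p)
    (hpos : ∀ p, p ≠ 0 → 0 < φ (p * p)) (n : ℕ) : ∀ k < n, φ (orthPoly φ n * X ^ k) = 0 := by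
  have key : ∀ n, (∀ k < n, φ (orthPoly φ n * X ^ k) = 0) ∧
      (∀ k < n + 1, φ (orthPoly φ (n + 1) * X ^ k) = 0) := by
    intro n
    induction n with
    | zero =>
      refine ⟨fun k hk => absurd hk (by omega), fun k hk => ?_⟩
      obtain rfl : k = 0 := by omega
      exact map_eq_zero_of_comp_neg hsym (by simp [orthPoly])
    | succ n ih =>
      refine ⟨ih.2, fun k hk => ?_⟩
      obtain ⟨ih1, ih2⟩ := ih
      have hrec : orthPoly φ (n + 2) * X ^ k = orthPoly φ (n + 1) * X ^ (k + 1) -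
          C (φ (orthPoly φ (n + 1) * orthPoly φ (n + 1)) / φ (orthPoly φ n * orthPoly φ n)) *
            (orthPoly φ n * X ^ k) := by
        rw [orthPoly]; ring
      rcases lt_trichotomy k n with hkn | rfl | hkn
      · rw [hrec, map_sub, map_C_mul, ih1 k hkn, ih2 (k + 1) (by omega)]
        simp
      · have e1 : φ (orthPoly φ (k + 1) * X ^ (k + 1)) =
            φ (orthPoly φ (k + 1) * orthPoly φ (k + 1)) :=
          map_mul_eq_of_monic ih2 (monic_X_pow _) (by simp)
            (orthPoly_monic_degree φ _).1 (orthPoly_monic_degree φ _).2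
        have e2 : φ (orthPoly φ k * X ^ k) = φ (orthPoly φ k * orthPoly φ k) :=
          map_mul_eq_of_monic ih1 (monic_X_pow _) (by simp)
            (orthPoly_monic_degree φ _).1 (orthPoly_monic_degree φ _).2
        have hne : φ (orthPoly φ k * orthPoly φ k) ≠ 0 := (hpos _ (orthPoly_ne_zero φ k)).ne'
        rw [hrec, map_sub, map_C_mul, e1, e2, div_mul_cancel₀ _ hne, sub_self]
      · obtain rfl : k = n + 1 := by omega
        refine map_eq_zero_of_comp_neg hsym ?_
        rw [mul_comp, orthPoly_comp_neg_X, pow_comp, X_comp, neg_pow]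
        have : ((-1 : ℝ[X]) ^ (n + 1)) * (-1) ^ (n + 1) = 1 := by
          rw [← mul_pow]; simp
        linear_combination (-(orthPoly φ (n + 2)) * X ^ (n + 1)) * this
  exact (key n).1

lemma map_orthPoly_mul_orthPoly_of_ne (hsym : ∀ p, φ (p.comp (-X)) = φ p)
    (hpos : ∀ p, p ≠ 0 → 0 < φ (p * p)) {m n : ℕ} (hmn : m ≠ n) :
    φ (orthPoly φ m * orthPoly φ n) = 0 := by
  rcases lt_or_gt_of_ne hmn with h | h
  · rw [mul_comm]
    exact map_mul_eq_zero_of_degree_lt (map_orthPoly_mul_X_pow hsym hpos n)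
      (by rw [(orthPoly_monic_degree φ m).2]; exact_mod_cast h)
  · exact map_mul_eq_zero_of_degree_lt (map_orthPoly_mul_X_pow hsym hpos m)
      (by rw [(orthPoly_monic_degree φ n).2]; exact_mod_cast h)

lemma map_X_mul_orthPoly_mul_succ (hsym : ∀ p, φ (p.comp (-X)) = φ p)
    (hpos : ∀ p, p ≠ 0 → 0 < φ (p * p)) (n : ℕ) :
    φ (X * orthPoly φ (n + 1) * orthPoly φ n) = φ (orthPoly φ (n + 1) * orthPoly φ (n + 1)) := by
  rw [mul_comm X, mul_assoc]
  refine map_mul_eq_of_monic (map_orthPoly_mul_X_pow hsym hpos (n + 1))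
    (monic_X.mul (orthPoly_monic_degree φ n).1) ?_
    (orthPoly_monic_degree φ _).1 (orthPoly_monic_degree φ _).2
  rw [degree_mul, degree_X, (orthPoly_monic_degree φ n).2]
  norm_cast; ring

/-- `X * p' - n * p` has degree below `n` for a monic `p` of degree `n`. -/
lemma map_derivative_X_mul_sq (hsym : ∀ p, φ (p.comp (-X)) = φ p)
    (hpos : ∀ p, p ≠ 0 → 0 < φ (p * p)) (n : ℕ) :
    φ (derivative (X * (orthPoly φ n * orthPoly φ n))) =
      (2 * n + 1) * φ (orthPoly φ n * orthPoly φ n) := by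
  set p := orthPoly φ n with hp
  have hd : derivative (X * (p * p)) = p * p + C 2 * (p * (X * derivative p)) := by
    simp only [derivative_mul, derivative_X, map_ofNat]
    ring
  have hlow : φ (p * (X * derivative p - C (n : ℝ) * p)) = 0 := by
    refine map_mul_eq_zero_of_degree_lt (map_orthPoly_mul_X_pow hsym hpos n) ?_
    rw [degree_lt_iff_coeff_zero]
    intro k hk
    rcases k with _ | k
    · have : n = 0 := by omega
      simp [this]
    · rw [coeff_sub, coeff_X_mul, coeff_C_mul, coeff_derivative]
      rcases (show n = k + 1 ∨ n < k + 1 by omega) with h | h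
      · rw [h]; push_cast; ring
      · rw [coeff_eq_zero_of_natDegree_lt (by rw [hp, natDegree_orthPoly]; exact h)]
        simp
  rw [mul_sub, map_sub, sub_eq_zero, mul_left_comm p (C (n : ℝ)), map_C_mul] at hlow
  rw [hd, map_add, map_C_mul, hlow]
  ring

/-- The recursion coefficients of the orthogonal polynomials grow at most quadratically when the
functional satisfies a weighted Cauchy-Schwarz inequality, as the Laplace distribution does with
weight `|x|`. -/
lemma map_orthPoly_succ_le (hsym : ∀ p, φ (p.comp (-X)) = φ p)
    (hpos : ∀ p, p ≠ 0 → 0 < φ (p * p)) {b : ℝ}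
    (hcs : ∀ p q, φ (X * p * q) ^ 2 ≤
      b ^ 2 * φ (derivative (X * (p * p))) * φ (derivative (X * (q * q)))) (n : ℕ) :
    φ (orthPoly φ (n + 1) * orthPoly φ (n + 1)) ≤
      b ^ 2 * (4 * (n + 1) ^ 2 - 1) * φ (orthPoly φ n * orthPoly φ n) := by
  have h := hcs (orthPoly φ (n + 1)) (orthPoly φ n)
  rw [map_X_mul_orthPoly_mul_succ hsym hpos, map_derivative_X_mul_sq hsym hpos,
    map_derivative_X_mul_sq hsym hpos] at h
  have hp := hpos _ (orthPoly_ne_zero φ (n + 1))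
  push_cast at h
  nlinarith

end OrthogonalPolynomials


/-! ### Moments of the Laplace distribution -/

section Laplace

open Polynomial

lemma integral_laplaceMeasure {b : ℝ} (hb : 0 < b) (f : ℝ → ℝ) :
    ∫ x, f x ∂(laplaceMeasure 0 b) = ∫ x, Real.exp (-|x| / b) / (2 * b) * f x := by
  rw [laplaceMeasure, integral_withDensity_eq_integral_toReal_smul (by fun_prop) (by simp)]
  refine integral_congr_ae (Filter.Eventually.of_forall fun x => ?_)
  have : 0 ≤ Real.exp (-|x| / b) / (2 * b) := by positivity
  simp [ENNReal.toReal_ofReal this]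

lemma integral_abs_pow_laplaceMeasure {b : ℝ} (hb : 0 < b) (k : ℕ) :
    ∫ x, |x| ^ k ∂(laplaceMeasure 0 b) = (k.factorial : ℝ) * b ^ k := by
  rw [integral_laplaceMeasure hb]
  rw [integral_comp_abs (f := fun x => Real.exp (-x / b) / (2 * b) * x ^ k)]
  have h := Real.integral_rpow_mul_exp_neg_mul_Ioi (a := k + 1) (r := 1 / b) (by positivity)
    (by positivity)
  have h2 : ∫ x in Set.Ioi (0 : ℝ), Real.exp (-x / b) / (2 * b) * x ^ k =
      (1 / (2 * b)) * ∫ t in Set.Ioi (0 : ℝ), t ^ ((k + 1 : ℝ) - 1) * Real.exp (-(1 / b * t)) := by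
    rw [← integral_const_mul]
    refine integral_congr_ae (Filter.Eventually.of_forall fun x => ?_)
    simp only [add_sub_cancel_right, Real.rpow_natCast]
    rw [show -x / b = -(1 / b * x) by ring]
    ring
  rw [h2, h, Real.Gamma_nat_eq_factorial, one_div_one_div]
  rw [show ((k : ℝ) + 1) = ((k + 1 : ℕ) : ℝ) by push_cast; ring, Real.rpow_natCast]
  field_simp
  ring

lemma integrable_abs_pow_laplaceMeasure {b : ℝ} (hb : 0 < b) (k : ℕ) :
    Integrable (fun x => |x| ^ k) (laplaceMeasure 0 b) := by
  refine Integrable.of_integral_ne_zero ?_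
  rw [integral_abs_pow_laplaceMeasure hb]
  positivity

lemma isProbabilityMeasure_laplaceMeasure {b : ℝ} (hb : 0 < b) :
    IsProbabilityMeasure (laplaceMeasure 0 b) := by
  have h := integral_abs_pow_laplaceMeasure hb 0
  simp only [pow_zero, integral_const, smul_eq_mul, mul_one, Nat.factorial_zero, Nat.cast_one,
    Measure.real] at h
  exact ⟨by rwa [ENNReal.toReal_eq_one_iff] at h⟩

lemma integrable_polynomial_laplaceMeasure {b : ℝ} (hb : 0 < b) (p : ℝ[X]) :
    Integrable (fun x => p.eval x) (laplaceMeasure 0 b) := by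
  simp only [eval_eq_sum_range]
  refine integrable_finsetSum _ fun k _ => Integrable.const_mul ?_ _
  refine (integrable_abs_pow_laplaceMeasure hb k).mono' (by fun_prop) ?_
  exact Filter.Eventually.of_forall fun x => by simp

lemma integrable_abs_mul_polynomial_laplaceMeasure {b : ℝ} (hb : 0 < b) (p : ℝ[X]) :
    Integrable (fun x => |x| * p.eval x) (laplaceMeasure 0 b) := by
  refine (integrable_polynomial_laplaceMeasure hb (X * p)).mono (by fun_prop) ?_
  exact Filter.Eventually.of_forall fun x => by simp

/-- Expectation under the Laplace distribution, as a functional on polynomials. -/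
noncomputable def laplaceFunctional {b : ℝ} (hb : 0 < b) : ℝ[X] →ₗ[ℝ] ℝ where
  toFun p := ∫ x, p.eval x ∂(laplaceMeasure 0 b)
  map_add' p q := by
    simp only [eval_add]
    exact integral_add (integrable_polynomial_laplaceMeasure hb p)
      (integrable_polynomial_laplaceMeasure hb q)
  map_smul' c p := by
    simp only [eval_smul, smul_eq_mul, RingHom.id_apply]
    exact integral_const_mul _ _

variable {b : ℝ} (hb : 0 < b)

lemma laplaceFunctional_apply (p : ℝ[X]) :
    laplaceFunctional hb p = ∫ x, p.eval x ∂(laplaceMeasure 0 b) := rfl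

lemma integral_comp_neg_laplaceMeasure {b : ℝ} (hb : 0 < b) (f : ℝ → ℝ) :
    ∫ x, f (-x) ∂(laplaceMeasure 0 b) = ∫ x, f x ∂(laplaceMeasure 0 b) := by
  rw [integral_laplaceMeasure hb, integral_laplaceMeasure hb]
  rw [← integral_neg_eq_self (fun x => Real.exp (-|x| / b) / (2 * b) * f x)]
  simp

lemma laplaceFunctional_comp_neg (p : ℝ[X]) :
    laplaceFunctional hb (p.comp (-X)) = laplaceFunctional hb p := by
  simp only [laplaceFunctional_apply, eval_comp, eval_neg, eval_X]
  exact integral_comp_neg_laplaceMeasure hb (fun x => p.eval x)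

lemma laplaceFunctional_mul_self_pos (p : ℝ[X]) (hp : p ≠ 0) :
    0 < laplaceFunctional hb (p * p) := by
  rw [laplaceFunctional_apply]
  refine (integral_pos_iff_support_of_nonneg (fun x => ?_)
    (integrable_polynomial_laplaceMeasure hb _)).2 ?_
  · simpa using mul_self_nonneg (p.eval x)
  · have := isProbabilityMeasure_laplaceMeasure hb
    have hfin : {x | p.IsRoot x}.Finite := by
      by_contra h
      exact hp (eq_zero_of_infinite_isRoot p h)
    have hnull : laplaceMeasure 0 b {x | p.IsRoot x} = 0 :=
      withDensity_absolutelyContinuous _ _ (hfin.measure_zero volume)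
    have hsupp : Function.support (fun x => (p * p).eval x) = {x | p.IsRoot x}ᶜ := by
      ext x
      simp [IsRoot]
    rw [hsupp, (prob_compl_eq_one_iff₀ hfin.measurableSet.nullMeasurableSet).2 hnull]
    exact one_pos

/-- Integration by parts: `|x|` is (up to the factor `b`) the logarithmic derivative of the density
times `x`. On monomials both sides are `(k + 1)! b ^ (k + 1)` for even `k` and vanish for odd
`k`. -/
lemma integral_abs_mul_laplaceMeasure (p : ℝ[X]) :
    ∫ x, |x| * p.eval x ∂(laplaceMeasure 0 b) =
      b * laplaceFunctional hb (derivative (X * p)) := by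
  have hmono : ∀ k : ℕ, ∫ x, |x| * x ^ k ∂(laplaceMeasure 0 b) =
      b * laplaceFunctional hb (derivative (X * X ^ k)) := by
    intro k
    have hR : laplaceFunctional hb (derivative (X * X ^ k)) =
        (k + 1) * ∫ x, x ^ k ∂(laplaceMeasure 0 b) := by
      rw [← pow_succ', derivative_X_pow, map_C_mul]
      simp [laplaceFunctional_apply]
    rw [hR]
    rcases Nat.even_or_odd k with hk | hk
    · have h1 : ∀ x : ℝ, |x| * x ^ k = |x| ^ (k + 1) := fun x => by
        rw [pow_succ', ← hk.pow_abs x]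
      have h2 : ∀ x : ℝ, x ^ k = |x| ^ k := fun x => (hk.pow_abs x).symm
      rw [integral_congr_ae (Filter.Eventually.of_forall h1),
        integral_congr_ae (Filter.Eventually.of_forall h2)]
      rw [integral_abs_pow_laplaceMeasure hb, integral_abs_pow_laplaceMeasure hb,
        Nat.factorial_succ]
      push_cast
      ring
    · have hz : ∀ f : ℝ → ℝ, (∀ x, f (-x) = -f x) → ∫ x, f x ∂(laplaceMeasure 0 b) = 0 := by
        intro f hf
        have h := integral_comp_neg_laplaceMeasure hb f
        simp_rw [hf, integral_neg] at h
        linarith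
      rw [hz (fun x => x ^ k) fun x => hk.neg_pow x, hz (fun x => |x| * x ^ k) fun x => by
        rw [abs_neg, hk.neg_pow]; ring]
      simp
  let L : ℝ[X] →ₗ[ℝ] ℝ :=
    { toFun := fun p => ∫ x, |x| * p.eval x ∂(laplaceMeasure 0 b)
      map_add' := fun p q => by
        simp only [eval_add, mul_add]
        exact integral_add (integrable_abs_mul_polynomial_laplaceMeasure hb p)
          (integrable_abs_mul_polynomial_laplaceMeasure hb q)
      map_smul' := fun c p => by
        simp only [eval_smul, smul_eq_mul, RingHom.id_apply]
        rw [← integral_const_mul]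
        congr 1; ext x; ring }
  change L p = _
  rw [p.as_sum_range_C_mul_X_pow, map_sum, Finset.mul_sum, derivative_sum, map_sum, Finset.mul_sum]
  refine Finset.sum_congr rfl fun k _ => ?_
  have := hmono k
  rw [map_C_mul, mul_left_comm X, derivative_C_mul, map_C_mul]
  have hL : L (X ^ k) = ∫ x, |x| * x ^ k ∂(laplaceMeasure 0 b) := by simp [L]
  rw [hL, this]
  ring

lemma laplaceFunctional_cauchySchwarz (p q : ℝ[X]) :
    laplaceFunctional hb (X * p * q) ^ 2 ≤ b ^ 2 * laplaceFunctional hb (derivative (X * (p * p))) *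
      laplaceFunctional hb (derivative (X * (q * q))) := by
  set μ := laplaceMeasure 0 b
  have habs : |laplaceFunctional hb (X * p * q)| ≤ ∫ x, |x| * (|p.eval x| * |q.eval x|) ∂μ := by
    rw [laplaceFunctional_apply]
    refine (abs_integral_le_integral_abs).trans (le_of_eq ?_)
    congr 1; ext x
    simp [abs_mul, mul_assoc]
  have hint : Integrable (fun x => |x| * (|p.eval x| * |q.eval x|)) μ := by
    refine (integrable_abs_mul_polynomial_laplaceMeasure hb (p * q)).mono (by fun_prop) ?_
    exact Filter.Eventually.of_forall fun x => by simp
  have hip := integrable_abs_mul_polynomial_laplaceMeasure hb (p * p)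
  have hiq := integrable_abs_mul_polynomial_laplaceMeasure hb (q * q)
  have hdisc : ∀ t : ℝ, 0 ≤ (∫ x, |x| * (p * p).eval x ∂μ) * (t * t) +
      (-(2 * ∫ x, |x| * (|p.eval x| * |q.eval x|) ∂μ)) * t + ∫ x, |x| * (q * q).eval x ∂μ := by
    intro t
    have : 0 ≤ ∫ x, |x| * (t * |p.eval x| - |q.eval x|) ^ 2 ∂μ :=
      integral_nonneg fun x => by positivity
    refine this.trans (le_of_eq ?_)
    have e : ∀ x : ℝ, |x| * (t * |p.eval x| - |q.eval x|) ^ 2 =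
        (t * t) * (|x| * (p * p).eval x) + (-(2 * t)) * (|x| * (|p.eval x| * |q.eval x|)) +
          |x| * (q * q).eval x := by
      intro x
      have h1 := abs_mul_abs_self (p.eval x)
      have h2 := abs_mul_abs_self (q.eval x)
      simp only [eval_mul]
      linear_combination (|x| * t ^ 2) * h1 + |x| * h2
    simp_rw [e]
    have i1 : Integrable (fun x => t * t * (|x| * (p * p).eval x) +
        -(2 * t) * (|x| * (|p.eval x| * |q.eval x|))) μ :=
      (hip.const_mul _).add (hint.const_mul _)
    rw [integral_add i1 hiq,
      integral_add (hip.const_mul _) (hint.const_mul _), integral_const_mul, integral_const_mul]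
    ring
  have hd := discrim_le_zero hdisc
  rw [discrim, integral_abs_mul_laplaceMeasure hb, integral_abs_mul_laplaceMeasure hb] at hd
  have hsq : laplaceFunctional hb (X * p * q) ^ 2 ≤
      (∫ x, |x| * (|p.eval x| * |q.eval x|) ∂μ) ^ 2 := by
    rw [← sq_abs]
    exact pow_le_pow_left₀ (abs_nonneg _) habs 2
  nlinarith

/-! ### The orthonormal polynomials of the Laplace distribution -/

/-- The recursion coefficients of the orthonormal polynomials: `x eₙ = αₙ₊₁ eₙ₊₁ + αₙ eₙ₋₁`. -/
noncomputable def laplaceCoeff : ℕ → ℝ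
  | 0 => 0
  | n + 1 => √(laplaceFunctional hb (orthPoly (laplaceFunctional hb) (n + 1) *
      orthPoly (laplaceFunctional hb) (n + 1)) / laplaceFunctional hb
        (orthPoly (laplaceFunctional hb) n * orthPoly (laplaceFunctional hb) n))

/-- The orthonormal polynomials of the Laplace distribution, as functions. -/
noncomputable def laplaceOrtho (n : ℕ) (x : ℝ) : ℝ :=
  (orthPoly (laplaceFunctional hb) n).eval x /
    √(laplaceFunctional hb (orthPoly (laplaceFunctional hb) n * orthPoly (laplaceFunctional hb) n))

lemma laplaceFunctional_orthPoly_pos (n : ℕ) : 0 < laplaceFunctional hb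
    (orthPoly (laplaceFunctional hb) n * orthPoly (laplaceFunctional hb) n) :=
  laplaceFunctional_mul_self_pos hb _ (orthPoly_ne_zero _ n)

lemma laplaceCoeff_zero : laplaceCoeff hb 0 = 0 := rfl

lemma laplaceCoeff_succ_sq (n : ℕ) : laplaceCoeff hb (n + 1) ^ 2 ≤
    b ^ 2 * (4 * ((n : ℝ) + 1) ^ 2 - 1) := by
  have h := laplaceFunctional_orthPoly_pos hb
  rw [laplaceCoeff, Real.sq_sqrt (div_nonneg (h _).le (h _).le), div_le_iff₀ (h n)]
  exact map_orthPoly_succ_le (laplaceFunctional_comp_neg hb) (laplaceFunctional_mul_self_pos hb)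
    (laplaceFunctional_cauchySchwarz hb) n

lemma laplaceCoeff_one_sq : laplaceCoeff hb 1 ^ 2 = 2 * b ^ 2 := by
  have h := laplaceFunctional_orthPoly_pos hb
  have h0 := integral_abs_pow_laplaceMeasure hb 0
  have h2 := integral_abs_pow_laplaceMeasure hb 2
  simp only [sq_abs, pow_zero, Nat.factorial] at h0 h2
  rw [laplaceCoeff, Real.sq_sqrt (div_nonneg (h _).le (h _).le)]
  have e : ∀ x : ℝ, x * x = x ^ 2 := fun x => by ring
  simp only [laplaceFunctional_apply, orthPoly, eval_mul, eval_X, eval_one, mul_one, e]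
  rw [h0, h2]
  norm_num

lemma laplaceOrtho_zero (x : ℝ) : laplaceOrtho hb 0 x = 1 := by
  have h0 := integral_abs_pow_laplaceMeasure hb 0
  simp only [pow_zero, Nat.factorial] at h0
  simp only [laplaceOrtho, laplaceFunctional_apply, orthPoly, eval_one, mul_one]
  rw [h0]
  simp

lemma continuous_laplaceOrtho (n : ℕ) : Continuous (laplaceOrtho hb n) :=
  (Polynomial.continuous _).div_const _

lemma integrable_laplaceOrtho_mul (m n : ℕ) :
    Integrable (fun x => laplaceOrtho hb m x * laplaceOrtho hb n x) (laplaceMeasure 0 b) := by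
  have h := (integrable_polynomial_laplaceMeasure hb (orthPoly (laplaceFunctional hb) m *
    orthPoly (laplaceFunctional hb) n)).div_const
      (√(laplaceFunctional hb (orthPoly (laplaceFunctional hb) m *
        orthPoly (laplaceFunctional hb) m)) * √(laplaceFunctional hb
          (orthPoly (laplaceFunctional hb) n * orthPoly (laplaceFunctional hb) n)))
  refine h.congr (Filter.Eventually.of_forall fun x => ?_)
  simp only [laplaceOrtho, eval_mul]
  rw [div_mul_div_comm]

lemma integral_laplaceOrtho_mul (m n : ℕ) :
    ∫ x, laplaceOrtho hb m x * laplaceOrtho hb n x ∂(laplaceMeasure 0 b) =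
      if m = n then 1 else 0 := by
  have h := laplaceFunctional_orthPoly_pos hb
  have e : ∫ x, laplaceOrtho hb m x * laplaceOrtho hb n x ∂(laplaceMeasure 0 b) =
      laplaceFunctional hb (orthPoly (laplaceFunctional hb) m * orthPoly (laplaceFunctional hb) n) /
      (√(laplaceFunctional hb (orthPoly (laplaceFunctional hb) m *
        orthPoly (laplaceFunctional hb) m)) * √(laplaceFunctional hb
          (orthPoly (laplaceFunctional hb) n * orthPoly (laplaceFunctional hb) n))) := by
    rw [laplaceFunctional_apply hb (_ * _), ← integral_div]
    congr 1; ext x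
    simp only [laplaceOrtho, eval_mul]
    rw [div_mul_div_comm]
  rw [e]
  split_ifs with hmn
  · subst hmn
    rw [Real.mul_self_sqrt (h m).le, div_self (h m).ne']
  · rw [map_orthPoly_mul_orthPoly_of_ne (laplaceFunctional_comp_neg hb)
      (laplaceFunctional_mul_self_pos hb) hmn, zero_div]

/-- For `n = 0` the truncated index `n - 1` is harmless, as `α₀ = 0`. -/
lemma mul_laplaceOrtho (n : ℕ) (x : ℝ) : x * laplaceOrtho hb n x =
    laplaceCoeff hb (n + 1) * laplaceOrtho hb (n + 1) x +
      laplaceCoeff hb n * laplaceOrtho hb (n - 1) x := by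
  have h := laplaceFunctional_orthPoly_pos hb
  rcases n with _ | n
  · have h0 := Real.sqrt_pos.2 (h 0)
    have h1 := Real.sqrt_pos.2 (h 1)
    simp only [laplaceOrtho, laplaceCoeff, Real.sqrt_div (h _).le]
    field_simp
    simp [orthPoly]
  · have h0 := Real.sqrt_pos.2 (h n)
    have h1 := Real.sqrt_pos.2 (h (n + 1))
    have h2 := Real.sqrt_pos.2 (h (n + 2))
    have hrec := congrArg (fun p => p.eval x) (X_mul_orthPoly (laplaceFunctional hb) n)
    simp only [eval_mul, eval_X, eval_add, eval_C] at hrec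
    simp only [laplaceOrtho, laplaceCoeff, Real.sqrt_div (h _).le, Nat.add_sub_cancel]
    rw [← mul_div_assoc, hrec]
    have e1 := Real.sq_sqrt (h n).le
    have e2 := Real.sq_sqrt (h (n + 1)).le
    generalize √(laplaceFunctional hb (orthPoly (laplaceFunctional hb) n *
      orthPoly (laplaceFunctional hb) n)) = s0 at *
    generalize √(laplaceFunctional hb (orthPoly (laplaceFunctional hb) (n + 1) *
      orthPoly (laplaceFunctional hb) (n + 1))) = s1 at *
    rw [← e1, ← e2]
    field_simp

end Laplace


/-! ### Multiplication by the matrix in the orthonormal product basis -/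

section Fock

variable {I R D : Type*} [Fintype I] [DecidableEq I] [Fintype R] [Fintype D]

/-- The multi-indices of total degree at most `m`. -/
def degLE (I : Type*) [Fintype I] [DecidableEq I] (m : ℕ) : Finset (I → ℕ) :=
  (Fintype.piFinset fun _ : I => Finset.range (m + 1)).filter fun n => ∑ p, n p ≤ m

lemma mem_degLE {m : ℕ} {n : I → ℕ} : n ∈ degLE I m ↔ ∑ p, n p ≤ m := by
  simp only [degLE, Finset.mem_filter, Fintype.mem_piFinset, Finset.mem_range, and_iff_right_iff_imp]
  intro h p
  have := Finset.single_le_sum (f := n) (fun _ _ => Nat.zero_le _) (Finset.mem_univ p)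
  omega

lemma degLE_mono {m m' : ℕ} (h : m ≤ m') : degLE I m ⊆ degLE I m' := fun _ hn =>
  mem_degLE.2 ((mem_degLE.1 hn).trans h)

lemma sum_add_single (n : I → ℕ) (p : I) : ∑ q, (n + Pi.single p 1 : I → ℕ) q = ∑ q, n q + 1 := by
  simp [Finset.sum_add_distrib]

lemma sub_single_add_single {I : Type*} [DecidableEq I] {n : I → ℕ} {p : I} (h : n p ≠ 0) :
    n - Pi.single p 1 + Pi.single p 1 = n := by
  ext q
  rcases eq_or_ne q p with rfl | hq
  · simp; omega
  · simp [hq]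

/-- Reindexing by `n ↦ n + Pi.single p 1`, which reaches exactly the `n` with `n p ≠ 0`. -/
lemma sum_degLE_succ (m : ℕ) (p : I) (G : (I → ℕ) → ℝ) (hG : ∀ n, n p = 0 → G n = 0) :
    ∑ n ∈ degLE I (m + 1), G n = ∑ n ∈ degLE I m, G (n + Pi.single p 1) := by
  have hinj : Set.InjOn (fun n : I → ℕ => n + Pi.single p 1) (degLE I m) :=
    fun a _ b _ h => by simpa using h
  rw [← Finset.sum_image (f := G) hinj]
  symm
  refine Finset.sum_subset ?_ ?_
  · intro n hn
    obtain ⟨k, hk, rfl⟩ := Finset.mem_image.1 hn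
    have := mem_degLE.1 hk
    rw [mem_degLE, sum_add_single]
    omega
  · intro n hn hn'
    by_contra hne
    have hp : n p ≠ 0 := fun h => hne (hG n h)
    refine hn' (Finset.mem_image.2 ⟨n - Pi.single p 1, ?_, sub_single_add_single hp⟩)
    have h1 := sum_add_single (n - Pi.single p 1) p
    rw [sub_single_add_single hp] at h1
    have := mem_degLE.1 hn
    rw [mem_degLE]
    omega

lemma sum_degLE_of_support {m m' : ℕ} (h : m ≤ m') {G : (I → ℕ) → ℝ}
    (hG : ∀ n ∉ degLE I m, G n = 0) : ∑ n ∈ degLE I m', G n = ∑ n ∈ degLE I m, G n :=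
  (Finset.sum_subset (degLE_mono h) fun n _ hn => hG n hn).symm

/-- A real sequence with the growth of the Laplace recursion coefficients of scale `b`. -/
structure CoeffGrowth (b : ℝ) (α : ℕ → ℝ) : Prop where
  zero : α 0 = 0
  one : α 1 ^ 2 = 2 * b ^ 2
  succ : ∀ n : ℕ, α (n + 1) ^ 2 ≤ b ^ 2 * (4 * ((n : ℝ) + 1) ^ 2 - 1)

/-- The Schur weights of one row of `W`, where `N` is the degree in the entries of that row and `M`
bounds the total degree. The last term is kept linear in `N`, so that its sum over the rows is
bounded through the total degree alone. -/
lemma CoeffGrowth.row_le {b : ℝ} {α : ℕ → ℝ} (hα : CoeffGrowth b α) {k N M : ℕ} (hk : k ≤ N)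
    (hN : N ≤ M) : ((N : ℝ) + 1) * (α (k + 1) ^ 2 / ((k : ℝ) + 1)) ≤
      b ^ 2 * (2 + 8 * N + N * (4 * M + 1 / M)) := by
  have hb2 : 0 ≤ b ^ 2 := sq_nonneg b
  have hN0 : (0 : ℝ) ≤ N := Nat.cast_nonneg N
  have hM0 : (0 : ℝ) ≤ M := Nat.cast_nonneg M
  rcases k with _ | k
  · have h0 : 0 ≤ (N : ℝ) * (4 * M + 1 / M) := by positivity
    rw [Nat.cast_zero, zero_add, zero_add, div_one, hα.one]
    nlinarith
  · have hkN : ((k : ℝ) + 1 + 1) ≤ N + 1 := by exact_mod_cast Nat.succ_le_succ hk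
    have hk0 : (0 : ℝ) ≤ k := Nat.cast_nonneg k
    have hN1 : (1 : ℝ) ≤ N := by linarith
    have hNM : (N : ℝ) ≤ M := by exact_mod_cast hN
    have hsucc := hα.succ (k + 1)
    push_cast at hsucc ⊢
    set t : ℝ := (k : ℝ) + 1 + 1
    have ht : 0 < t := by positivity
    have h1 : α (k + 1 + 1) ^ 2 / t ≤ b ^ 2 * (4 * t - 1 / t) := by
      rw [div_le_iff₀ ht]
      refine hsucc.trans (le_of_eq ?_)
      field_simp
    have h2 : ((N : ℝ) + 1) * (4 * t - 1 / t) ≤ 4 * (N + 1) ^ 2 - 1 := by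
      have h3 : 1 ≤ ((N : ℝ) + 1) * (1 / t) := by
        rw [mul_one_div, le_div_iff₀ ht]; linarith
      nlinarith
    -- `4 x + 1 / x` increases on `[1, ∞)`
    have h4 : 4 * (N : ℝ) ^ 2 + 1 ≤ N * (4 * M + 1 / M) := by
      have hMp : (0 : ℝ) < M := by linarith
      have : (N : ℝ) * (4 * M + 1 / M) - (4 * N ^ 2 + 1) = (M - N) * (4 * N * M - 1) / M := by
        field_simp; ring
      have h5 : 0 ≤ ((M : ℝ) - N) * (4 * N * M - 1) / M := by
        refine div_nonneg (mul_nonneg (by linarith) ?_) hMp.le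
        nlinarith
      linarith
    calc ((N : ℝ) + 1) * (α (k + 1 + 1) ^ 2 / t)
        ≤ (N + 1) * (b ^ 2 * (4 * t - 1 / t)) := by gcongr
      _ = b ^ 2 * ((N + 1) * (4 * t - 1 / t)) := by ring
      _ ≤ b ^ 2 * (4 * (N + 1) ^ 2 - 1) := by gcongr
      _ ≤ _ := by gcongr; linarith

lemma sum_row_le_degree {ix : R → D → I} (hix : Function.Injective2 ix) (n : I → ℕ) :
    ∑ i, ∑ j, n (ix i j) ≤ ∑ p, n p := by
  rw [← Fintype.sum_prod_type' fun i j => n (ix i j)]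
  have hinj : Set.InjOn (fun x : R × D => ix x.1 x.2) (Finset.univ : Finset (R × D)) :=
    fun a _ c _ h => Prod.ext (hix h).1 (hix h).2
  rw [← Finset.sum_image (f := n) hinj]
  exact Finset.sum_le_sum_of_subset (Finset.subset_univ _)

/-- The column sums in Schur's test. The entries of degree `0` contribute `2 * card R`, the only
term that depends on the dimension. -/
lemma CoeffGrowth.sum_row_le {b : ℝ} {α : ℕ → ℝ} (hα : CoeffGrowth b α) {ix : R → D → I}
    (hix : Function.Injective2 ix) {m : ℕ} {n : I → ℕ} (hn : n ∈ degLE I m) (j : D) :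
    ∑ i, ((∑ l, (n (ix i l) : ℝ)) + 1) * (α (n (ix i j) + 1) ^ 2 / ((n (ix i j) : ℝ) + 1)) ≤
      b ^ 2 * (2 * Fintype.card R + (2 * m + 2) ^ 2) := by
  have htot : ∑ i, ∑ l, n (ix i l) ≤ m := (sum_row_le_degree hix n).trans (mem_degLE.1 hn)
  have hrow : ∀ i, ((∑ l, (n (ix i l) : ℝ)) + 1) *
      (α (n (ix i j) + 1) ^ 2 / ((n (ix i j) : ℝ) + 1)) ≤
      b ^ 2 * (2 + 8 * (∑ l, n (ix i l) : ℕ) + (∑ l, n (ix i l) : ℕ) * (4 * m + 1 / m)) := by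
    intro i
    have h1 : n (ix i j) ≤ ∑ l, n (ix i l) :=
      Finset.single_le_sum (f := fun l => n (ix i l)) (fun _ _ => Nat.zero_le _) (Finset.mem_univ j)
    have h2 : ∑ l, n (ix i l) ≤ m :=
      (Finset.single_le_sum (f := fun i => ∑ l, n (ix i l)) (fun _ _ => Nat.zero_le _)
        (Finset.mem_univ i)).trans htot
    have := hα.row_le h1 h2
    rwa [Nat.cast_sum] at this ⊢
  refine (Finset.sum_le_sum fun i _ => hrow i).trans ?_
  rw [← Finset.mul_sum]
  refine mul_le_mul_of_nonneg_left ?_ (sq_nonneg b)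
  rw [Finset.sum_add_distrib, Finset.sum_add_distrib, ← Finset.mul_sum, ← Finset.sum_mul,
    ← Nat.cast_sum]
  have hm : ((∑ i, ∑ l, n (ix i l) : ℕ) : ℝ) ≤ m := by exact_mod_cast htot
  have hm0 : (0 : ℝ) ≤ m := Nat.cast_nonneg m
  have hmul : ((∑ i, ∑ l, n (ix i l) : ℕ) : ℝ) * (4 * m + 1 / m) ≤ m * (4 * m + 1 / m) := by
    gcongr
  have hfin : (m : ℝ) * (4 * m + 1 / m) ≤ 4 * m ^ 2 + 1 := by
    rcases eq_or_ne (m : ℝ) 0 with h | h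
    · rw [h]; norm_num
    · have : (m : ℝ) * (4 * m + 1 / m) = 4 * m ^ 2 + 1 := by field_simp
      exact this.le
  simp only [Finset.sum_const, Finset.card_univ, nsmul_eq_mul]
  nlinarith

/-- The part of the multiplication operator that raises the degree. The array `c` holds the
coefficients of a vector of polynomials, one for each `j`; the truncated `n - Pi.single _ 1` only
matters where `α` does not vanish. -/
def raisePart (α : ℕ → ℝ) (ix : R → D → I) (c : (I → ℕ) → D → ℝ) (n : I → ℕ) (i : R) : ℝ :=
  ∑ j, α (n (ix i j)) * c (n - Pi.single (ix i j) 1) j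

/-- The part of the multiplication operator that lowers the degree. -/
def lowerPart (α : ℕ → ℝ) (ix : R → D → I) (c : (I → ℕ) → D → ℝ) (n : I → ℕ) (i : R) : ℝ :=
  ∑ j, α (n (ix i j) + 1) * c (n + Pi.single (ix i j) 1) j

lemma sum_row_add_single {I R D : Type*} [DecidableEq I] [Fintype D] {ix : R → D → I}
    (hix : Function.Injective2 ix) (n : I → ℕ) (i : R) (j : D) :
    ∑ l, (((n + Pi.single (ix i j) 1 : I → ℕ) (ix i l) : ℕ) : ℝ) =
      ∑ l, (n (ix i l) : ℝ) + 1 := by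
  classical
  have : ∀ l, (((n + Pi.single (ix i j) 1 : I → ℕ) (ix i l) : ℕ) : ℝ) =
      (n (ix i l) : ℝ) + if l = j then 1 else 0 := by
    intro l
    rcases eq_or_ne l j with rfl | h
    · simp
    · have h' : ix i l ≠ ix i j := fun e => h (hix e).2
      simp [h, h']
  simp_rw [this]
  rw [Finset.sum_add_distrib]
  simp

/-- Schur's test for the raising part, with the multiplicities `n (ix i j)` as weights. -/
lemma CoeffGrowth.sum_raisePart_sq_le {b : ℝ} {α : ℕ → ℝ} (hα : CoeffGrowth b α) {ix : R → D → I}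
    (hix : Function.Injective2 ix) (m : ℕ) (c : (I → ℕ) → D → ℝ) :
    ∑ n ∈ degLE I (m + 1), ∑ i, raisePart α ix c n i ^ 2 ≤
      b ^ 2 * (2 * Fintype.card R + (2 * m + 2) ^ 2) * ∑ n ∈ degLE I m, ∑ j, c n j ^ 2 := by
  have hcs : ∀ n i, raisePart α ix c n i ^ 2 ≤ ∑ j, (∑ l, (n (ix i l) : ℝ)) *
      (α (n (ix i j)) ^ 2 / (n (ix i j) : ℝ) * c (n - Pi.single (ix i j) 1) j ^ 2) := by
    intro n i
    rw [← Finset.mul_sum]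
    refine Finset.sum_sq_le_sum_mul_sum_of_sq_le_mul _ (fun j _ => Nat.cast_nonneg _)
      (fun j _ => by positivity) fun j _ => ?_
    rcases Nat.eq_zero_or_pos (n (ix i j)) with h | h
    · simp [h, hα.zero]
    · have : (n (ix i j) : ℝ) ≠ 0 := by exact_mod_cast h.ne'
      refine le_of_eq ?_
      field_simp
  calc ∑ n ∈ degLE I (m + 1), ∑ i, raisePart α ix c n i ^ 2
      ≤ ∑ n ∈ degLE I (m + 1), ∑ i, ∑ j, (∑ l, (n (ix i l) : ℝ)) *
        (α (n (ix i j)) ^ 2 / (n (ix i j) : ℝ) * c (n - Pi.single (ix i j) 1) j ^ 2) :=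
        Finset.sum_le_sum fun n _ => Finset.sum_le_sum fun i _ => hcs n i
    _ = ∑ i, ∑ j, ∑ n ∈ degLE I (m + 1), (∑ l, (n (ix i l) : ℝ)) *
        (α (n (ix i j)) ^ 2 / (n (ix i j) : ℝ) * c (n - Pi.single (ix i j) 1) j ^ 2) := by
        rw [Finset.sum_comm]
        exact Finset.sum_congr rfl fun i _ => Finset.sum_comm
    _ = ∑ i, ∑ j, ∑ n ∈ degLE I m, ((∑ l, (n (ix i l) : ℝ)) + 1) *
        (α (n (ix i j) + 1) ^ 2 / ((n (ix i j) : ℝ) + 1) * c n j ^ 2) := by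
        refine Finset.sum_congr rfl fun i _ => Finset.sum_congr rfl fun j _ => ?_
        rw [sum_degLE_succ m (ix i j) _ fun n h => by simp [h]]
        refine Finset.sum_congr rfl fun n _ => ?_
        rw [sum_row_add_single hix, add_tsub_cancel_right]
        simp
    _ = ∑ n ∈ degLE I m, ∑ j, (∑ i, ((∑ l, (n (ix i l) : ℝ)) + 1) *
        (α (n (ix i j) + 1) ^ 2 / ((n (ix i j) : ℝ) + 1))) * c n j ^ 2 := by
        rw [Finset.sum_comm, Finset.sum_comm (s := degLE I m)]
        refine Finset.sum_congr rfl fun j _ => ?_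
        rw [Finset.sum_comm]
        refine Finset.sum_congr rfl fun n _ => ?_
        rw [Finset.sum_mul]
        exact Finset.sum_congr rfl fun i _ => by ring
    _ ≤ ∑ n ∈ degLE I m, ∑ j, b ^ 2 * (2 * Fintype.card R + (2 * m + 2) ^ 2) * c n j ^ 2 := by
        refine Finset.sum_le_sum fun n hn => Finset.sum_le_sum fun j _ => ?_
        exact mul_le_mul_of_nonneg_right (hα.sum_row_le hix hn j) (sq_nonneg _)
    _ = _ := by simp_rw [Finset.mul_sum]

/-- Schur's test for the lowering part. Its kernel is the transpose of a raising kernel, whence the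
weights `(column sum + 1) / (n (ix i j) + 1)` and the dimension `D` in place of `R`. -/
lemma CoeffGrowth.sum_lowerPart_sq_le {b : ℝ} {α : ℕ → ℝ} (hα : CoeffGrowth b α) {ix : R → D → I}
    (hix : Function.Injective2 ix) (m : ℕ) {c : (I → ℕ) → D → ℝ}
    (hc : ∀ n ∉ degLE I m, ∀ j, c n j = 0) :
    ∑ n ∈ degLE I (m + 1), ∑ i, lowerPart α ix c n i ^ 2 ≤
      b ^ 2 * (2 * Fintype.card D + (2 * m + 2) ^ 2) * ∑ n ∈ degLE I m, ∑ j, c n j ^ 2 := by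
  have hix' : Function.Injective2 fun j i => ix i j := fun _ _ _ _ h => (hix h).symm
  set K : ℝ := b ^ 2 * (2 * Fintype.card D + (2 * m + 2) ^ 2) with hK
  have hK0 : 0 ≤ K := by positivity
  -- the summand after the test, as a function of the raised multi-index
  let G : R → D → (I → ℕ) → ℝ := fun i j n =>
    (n (ix i j) : ℝ) / (∑ k, (n (ix k j) : ℝ)) * c n j ^ 2
  have hcs : ∀ n i, lowerPart α ix c n i ^ 2 ≤ K * ∑ j, G i j (n + Pi.single (ix i j) 1) := by
    intro n i
    have hG : ∀ j, G i j (n + Pi.single (ix i j) 1) = ((n (ix i j) : ℝ) + 1) /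
        (∑ k, (n (ix k j) : ℝ) + 1) * c (n + Pi.single (ix i j) 1) j ^ 2 := by
      intro j
      simp only [G]
      rw [sum_row_add_single hix' n j i]
      simp
    simp_rw [hG]
    by_cases hn : n ∈ degLE I m
    · refine le_trans (Finset.sum_sq_le_sum_mul_sum_of_sq_le_mul _
        (f := fun j => (∑ k, (n (ix k j) : ℝ) + 1) *
          (α (n (ix i j) + 1) ^ 2 / ((n (ix i j) : ℝ) + 1)))
        (g := fun j => ((n (ix i j) : ℝ) + 1) / (∑ k, (n (ix k j) : ℝ) + 1) *
          c (n + Pi.single (ix i j) 1) j ^ 2)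
        (fun j _ => by positivity) (fun j _ => by positivity) fun j _ => ?_) ?_
      · have h1 : (0 : ℝ) < ∑ k, (n (ix k j) : ℝ) + 1 := by positivity
        refine le_of_eq ?_
        field_simp
      · exact mul_le_mul_of_nonneg_right (hα.sum_row_le hix' hn i)
          (Finset.sum_nonneg fun j _ => by positivity)
    · have hz : ∀ j, c (n + Pi.single (ix i j) 1) j = 0 := by
        intro j
        refine hc _ (fun h => hn ?_) j
        rw [mem_degLE, sum_add_single] at h
        rw [mem_degLE]; omega
      simp [lowerPart, hz]
  calc ∑ n ∈ degLE I (m + 1), ∑ i, lowerPart α ix c n i ^ 2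
      ≤ ∑ n ∈ degLE I (m + 1), ∑ i, K * ∑ j, G i j (n + Pi.single (ix i j) 1) :=
        Finset.sum_le_sum fun n _ => Finset.sum_le_sum fun i _ => hcs n i
    _ = K * ∑ i, ∑ j, ∑ n ∈ degLE I (m + 1), G i j (n + Pi.single (ix i j) 1) := by
        simp_rw [← Finset.mul_sum]
        rw [Finset.sum_comm]
        congr 1
        exact Finset.sum_congr rfl fun i _ => Finset.sum_comm
    _ = K * ∑ i, ∑ j, ∑ n ∈ degLE I m, G i j n := by
        congr 1
        refine Finset.sum_congr rfl fun i _ => Finset.sum_congr rfl fun j _ => ?_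
        rw [← sum_degLE_succ (m + 1) (ix i j) (G i j) fun n h => by simp [G, h]]
        exact sum_degLE_of_support (by omega) fun n hn => by simp [G, hc n hn j]
    _ = K * ∑ n ∈ degLE I m, ∑ j, (∑ i, (n (ix i j) : ℝ) / (∑ k, (n (ix k j) : ℝ))) *
          c n j ^ 2 := by
        congr 1
        rw [Finset.sum_comm, Finset.sum_comm (s := degLE I m)]
        refine Finset.sum_congr rfl fun j _ => ?_
        rw [Finset.sum_comm]
        refine Finset.sum_congr rfl fun n _ => ?_
        rw [Finset.sum_mul]
    _ ≤ K * ∑ n ∈ degLE I m, ∑ j, c n j ^ 2 := by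
        refine mul_le_mul_of_nonneg_left ?_ hK0
        refine Finset.sum_le_sum fun n _ => Finset.sum_le_sum fun j _ => ?_
        rw [← Finset.sum_div]
        exact mul_le_of_le_one_left (sq_nonneg _) (div_self_le_one _)

/-- One multiplication by a matrix `W` that acts on `Ψ` by the three-term recursion: the coefficient
array of `∑ j, W i j * f j`, and the growth of its norm. -/
lemma CoeffGrowth.exists_mul_coeff {b : ℝ} {α : ℕ → ℝ} (hα : CoeffGrowth b α) {ix : R → D → I}
    (hix : Function.Injective2 ix) (m : ℕ) {c : (I → ℕ) → D → ℝ}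
    (hc : ∀ n ∉ degLE I m, ∀ j, c n j = 0) :
    ∃ c' : (I → ℕ) → R → ℝ, (∀ n ∉ degLE I (m + 1), ∀ i, c' n i = 0) ∧
      (∑ n ∈ degLE I (m + 1), ∑ i, c' n i ^ 2 ≤
        4 * b ^ 2 * (Fintype.card R + Fintype.card D + (2 * m + 2) ^ 2) *
          ∑ n ∈ degLE I m, ∑ j, c n j ^ 2) ∧
      ∀ (w : I → ℝ) (Ψ : (I → ℕ) → ℝ),
        (∀ p n, w p * Ψ n = α (n p + 1) * Ψ (n + Pi.single p 1) +
          α (n p) * Ψ (n - Pi.single p 1)) →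
        ∀ i, ∑ j, w (ix i j) * ∑ n ∈ degLE I m, c n j * Ψ n =
          ∑ n ∈ degLE I (m + 1), c' n i * Ψ n := by
  refine ⟨fun n i => raisePart α ix c n i + lowerPart α ix c n i, ?_, ?_, ?_⟩
  · intro n hn i
    have h1 : ∀ j, α (n (ix i j)) * c (n - Pi.single (ix i j) 1) j = 0 := by
      intro j
      rcases eq_or_ne (n (ix i j)) 0 with h | h
      · rw [h, hα.zero, zero_mul]
      · rw [hc _ (fun h' => hn ?_) j, mul_zero]
        have h2 := sum_add_single (n - Pi.single (ix i j) 1) (ix i j)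
        rw [sub_single_add_single h] at h2
        rw [mem_degLE] at h' ⊢
        omega
    have h2 : ∀ j, c (n + Pi.single (ix i j) 1) j = 0 := by
      intro j
      refine hc _ (fun h => hn ?_) j
      rw [mem_degLE, sum_add_single] at h
      rw [mem_degLE]; omega
    simp [raisePart, lowerPart, h1, h2]
  · have h1 := hα.sum_raisePart_sq_le hix m c
    have h2 := hα.sum_lowerPart_sq_le hix m hc
    have h3 : ∑ n ∈ degLE I (m + 1), ∑ i, (raisePart α ix c n i + lowerPart α ix c n i) ^ 2 ≤
        2 * ∑ n ∈ degLE I (m + 1), ∑ i, raisePart α ix c n i ^ 2 +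
          2 * ∑ n ∈ degLE I (m + 1), ∑ i, lowerPart α ix c n i ^ 2 := by
      rw [Finset.mul_sum, Finset.mul_sum, ← Finset.sum_add_distrib]
      refine Finset.sum_le_sum fun n _ => ?_
      rw [Finset.mul_sum, Finset.mul_sum, ← Finset.sum_add_distrib]
      refine Finset.sum_le_sum fun i _ => ?_
      nlinarith [sq_nonneg (raisePart α ix c n i - lowerPart α ix c n i)]
    refine h3.trans ((add_le_add (mul_le_mul_of_nonneg_left h1 two_pos.le)
      (mul_le_mul_of_nonneg_left h2 two_pos.le)).trans (le_of_eq ?_))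
    ring
  · intro w Ψ hΨ i
    have hj : ∀ j, w (ix i j) * ∑ n ∈ degLE I m, c n j * Ψ n =
        ∑ n ∈ degLE I (m + 1), (α (n (ix i j)) * c (n - Pi.single (ix i j) 1) j * Ψ n +
          α (n (ix i j) + 1) * c (n + Pi.single (ix i j) 1) j * Ψ n) := by
      intro j
      have e1 : ∑ n ∈ degLE I (m + 1), α (n (ix i j)) * c (n - Pi.single (ix i j) 1) j * Ψ n =
          ∑ n ∈ degLE I m, c n j * (α (n (ix i j) + 1) * Ψ (n + Pi.single (ix i j) 1)) := by
        rw [sum_degLE_succ m (ix i j) _ fun n h => by simp [h, hα.zero]]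
        refine Finset.sum_congr rfl fun n _ => ?_
        rw [add_tsub_cancel_right]
        simp only [Pi.add_apply, Pi.single_eq_same]
        ring
      have e2 : ∑ n ∈ degLE I (m + 1), α (n (ix i j) + 1) * c (n + Pi.single (ix i j) 1) j * Ψ n =
          ∑ n ∈ degLE I m, c n j * (α (n (ix i j)) * Ψ (n - Pi.single (ix i j) 1)) := by
        rw [← sum_degLE_of_support (by omega : m ≤ m + 1 + 1) fun n hn => by simp [hc n hn j]]
        rw [sum_degLE_succ (m + 1) (ix i j) _ fun n h => by simp [h, hα.zero]]
        refine Finset.sum_congr rfl fun n _ => ?_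
        rw [add_tsub_cancel_right]
        simp only [Pi.add_apply, Pi.single_eq_same]
        ring
      rw [Finset.sum_add_distrib, e1, e2, ← Finset.sum_add_distrib, Finset.mul_sum]
      refine Finset.sum_congr rfl fun n _ => ?_
      rw [mul_left_comm, hΨ]
      ring
    simp_rw [hj]
    rw [Finset.sum_comm]
    refine Finset.sum_congr rfl fun n _ => ?_
    rw [Finset.sum_add_distrib, ← Finset.sum_mul, ← Finset.sum_mul, ← add_mul]
    rfl

end Fock


/-! ### Spectral norm and alternating powers of a matrix -/

section MatrixNorm

open Matrix
open scoped Matrix.Norms.L2Operator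

variable {R D : Type*} [Fintype R] [Fintype D] [DecidableEq D]

/-- The sum of the squared entries of the `k`-th of the alternating products
`1, A, AᵀA, AAᵀA, …`; their rows are indexed by `D` for even `k` and by `R` for odd `k`. -/
def altPowSq (A : Matrix R D ℝ) (k : ℕ) : ℝ :=
  if Even k then ∑ j₀, ∑ j, (((Aᵀ * A) ^ (k / 2)) j j₀) ^ 2
  else ∑ j₀, ∑ i, ((A * (Aᵀ * A) ^ (k / 2)) i j₀) ^ 2

lemma altPowSq_nonneg (A : Matrix R D ℝ) (k : ℕ) : 0 ≤ altPowSq A k := by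
  unfold altPowSq
  split_ifs <;> exact Finset.sum_nonneg fun _ _ => Finset.sum_nonneg fun _ _ => sq_nonneg _

lemma l2_opNorm_sq_le_sum_sq (A : Matrix R D ℝ) : ‖A‖ ^ 2 ≤ ∑ j, ∑ i, A i j ^ 2 := by
  have h0 : 0 ≤ ∑ j, ∑ i, A i j ^ 2 :=
    Finset.sum_nonneg fun _ _ => Finset.sum_nonneg fun _ _ => sq_nonneg _
  have h : ‖A‖ ≤ √(∑ j, ∑ i, A i j ^ 2) := by
    rw [l2_opNorm_def]
    refine ContinuousLinearMap.opNorm_le_bound _ (Real.sqrt_nonneg _) fun x => ?_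
    rw [← Real.sqrt_sq (norm_nonneg x), ← Real.sqrt_mul h0]
    refine Real.le_sqrt_of_sq_le ?_
    rw [EuclideanSpace.real_norm_sq_eq, EuclideanSpace.real_norm_sq_eq, Finset.sum_comm,
      Finset.sum_mul]
    refine Finset.sum_le_sum fun i _ => ?_
    simpa [Matrix.mulVec, dotProduct] using
      Finset.sum_mul_sq_le_sq_mul_sq Finset.univ (fun j => A i j) (fun j => x j)
  calc ‖A‖ ^ 2 ≤ √(∑ j, ∑ i, A i j ^ 2) ^ 2 := pow_le_pow_left₀ (norm_nonneg _) h 2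
    _ = _ := Real.sq_sqrt h0

/-- For exponents `2 ^ n` this is the `C⋆`-identity, and the other exponents follow by
submultiplicativity. -/
lemma l2_opNorm_pow_le [Nonempty D] {S : Matrix D D ℝ} (hS : IsSelfAdjoint S) (k : ℕ) :
    ‖S‖ ^ k ≤ ‖S ^ k‖ := by
  rcases eq_or_ne k 0 with rfl | hk0
  · simp
  obtain ⟨n, hn⟩ : ∃ n, k ≤ 2 ^ n := ⟨k, Nat.lt_two_pow_self.le⟩
  rcases eq_or_ne ‖S‖ 0 with h0 | h0
  · simp [h0, hk0]
  have hpos : 0 < ‖S‖ := lt_of_le_of_ne (norm_nonneg _) (Ne.symm h0)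
  rcases eq_or_lt_of_le hn with rfl | hlt
  · exact (hS.norm_pow_two_pow n).ge
  have h1 : ‖S‖ ^ k * ‖S‖ ^ (2 ^ n - k) ≤ ‖S ^ k‖ * ‖S‖ ^ (2 ^ n - k) := by
    rw [← pow_add, Nat.add_sub_cancel' hn, ← hS.norm_pow_two_pow n]
    nth_rewrite 1 [← Nat.add_sub_cancel' hn]
    rw [pow_add]
    refine (norm_mul_le _ _).trans ?_
    gcongr
    exact norm_pow_le' _ (by omega)
  exact le_of_mul_le_mul_right h1 (pow_pos hpos _)

/-- `‖A‖ ^ k` is at most the Hilbert-Schmidt norm of the `k`-th alternating power. -/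
lemma l2_opNorm_pow_le_altPowSq [Nonempty D] (A : Matrix R D ℝ) (k : ℕ) :
    ‖A‖ ^ (2 * k) ≤ altPowSq A k := by
  have hT : Aᵀ = Aᴴ := (conjTranspose_eq_transpose_of_trivial A).symm
  have hself : IsSelfAdjoint (Aᵀ * A) := by
    rw [hT]; exact (isHermitian_conjTranspose_mul_self A)
  have hnorm : ‖Aᵀ * A‖ = ‖A‖ ^ 2 := by
    rw [hT, l2_opNorm_conjTranspose_mul_self, pow_two]
  unfold altPowSq
  split_ifs with hk
  · obtain ⟨m, rfl⟩ := hk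
    refine le_trans ?_ (l2_opNorm_sq_le_sum_sq _)
    rw [show (m + m) / 2 = m by omega]
    calc ‖A‖ ^ (2 * (m + m)) = (‖Aᵀ * A‖ ^ m) ^ 2 := by rw [hnorm]; ring
      _ ≤ _ := pow_le_pow_left₀ (by positivity) (l2_opNorm_pow_le hself m) 2
  · obtain ⟨m, rfl⟩ := Nat.not_even_iff_odd.1 hk
    refine le_trans ?_ (l2_opNorm_sq_le_sum_sq _)
    rw [show (2 * m + 1) / 2 = m by omega]
    have hsq : ‖A * (Aᵀ * A) ^ m‖ ^ 2 = ‖(Aᵀ * A) ^ (2 * m + 1)‖ := by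
      rw [pow_two, ← l2_opNorm_conjTranspose_mul_self]
      congr 1
      rw [conjTranspose_mul, ((hself.pow m).isHermitian : ((Aᵀ * A) ^ m)ᴴ = _), ← hT]
      rw [show 2 * m + 1 = m + 1 + m by ring, pow_add, pow_succ]
      simp only [Matrix.mul_assoc]
    rw [hsq]
    calc ‖A‖ ^ (2 * (2 * m + 1)) = ‖Aᵀ * A‖ ^ (2 * m + 1) := by rw [hnorm]; ring
      _ ≤ _ := l2_opNorm_pow_le hself _

end MatrixNorm

/-! ### Moments of the spectral norm of a Laplace matrix -/

section RandomMatrix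

variable {Ω I : Type*} [MeasurableSpace Ω] [Fintype I] {P : Measure Ω}
  {b : ℝ} (hb : 0 < b)

lemma coeffGrowth_laplaceCoeff : CoeffGrowth b (laplaceCoeff hb) where
  zero := laplaceCoeff_zero hb
  one := laplaceCoeff_one_sq hb
  succ := laplaceCoeff_succ_sq hb

/-- The products of orthonormal polynomials in the coordinates: an orthonormal system for a family
of independent Laplace variables. -/
noncomputable def productOrtho (n : I → ℕ) (w : I → ℝ) : ℝ := ∏ p, laplaceOrtho hb (n p) (w p)

lemma mul_productOrtho [DecidableEq I] (p : I) (n : I → ℕ) (w : I → ℝ) :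
    w p * productOrtho hb n w =
      laplaceCoeff hb (n p + 1) * productOrtho hb (n + Pi.single p 1) w +
        laplaceCoeff hb (n p) * productOrtho hb (n - Pi.single p 1) w := by
  have hsplit : ∀ n' : I → ℕ, productOrtho hb n' w = laplaceOrtho hb (n' p) (w p) *
      ∏ q ∈ Finset.univ.erase p, laplaceOrtho hb (n' q) (w q) := fun n' =>
    (Finset.mul_prod_erase _ _ (Finset.mem_univ p)).symm
  have h1 : ∏ q ∈ Finset.univ.erase p, laplaceOrtho hb ((n + Pi.single p 1 : I → ℕ) q) (w q) =
      ∏ q ∈ Finset.univ.erase p, laplaceOrtho hb (n q) (w q) :=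
    Finset.prod_congr rfl fun q hq => by simp [Finset.ne_of_mem_erase hq]
  have h2 : ∏ q ∈ Finset.univ.erase p, laplaceOrtho hb ((n - Pi.single p 1 : I → ℕ) q) (w q) =
      ∏ q ∈ Finset.univ.erase p, laplaceOrtho hb (n q) (w q) :=
    Finset.prod_congr rfl fun q hq => by simp [Finset.ne_of_mem_erase hq]
  rw [hsplit n, hsplit (n + Pi.single p 1), hsplit (n - Pi.single p 1), h1, h2, ← mul_assoc,
    mul_laplaceOrtho]
  simp only [Pi.add_apply, Pi.sub_apply, Pi.single_eq_same]
  ring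

variable {w : I → Ω → ℝ} (hlaw : ∀ p, HasLaw (w p) (laplaceMeasure 0 b) P) (hind : iIndepFun w P)

include hlaw hind

lemma integral_productOrtho_mul (n n' : I → ℕ) :
    ∫ ω, productOrtho hb n (fun p => w p ω) * productOrtho hb n' (fun p => w p ω) ∂P =
      if n = n' then 1 else 0 := by
  have hcont := continuous_laplaceOrtho hb
  simp only [productOrtho, ← Finset.prod_mul_distrib]
  rw [hind.integral_fun_prod_comp
    (f := fun p x => laplaceOrtho hb (n p) x * laplaceOrtho hb (n' p) x)
    (fun p => (hlaw p).aemeasurable)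
    (fun p => ((hcont _).mul (hcont _)).aestronglyMeasurable)]
  have : ∀ p, ∫ ω, laplaceOrtho hb (n p) (w p ω) * laplaceOrtho hb (n' p) (w p ω) ∂P =
      if n p = n' p then 1 else 0 := by
    intro p
    rw [← integral_laplaceOrtho_mul hb]
    exact (hlaw p).integral_comp
      (f := fun x => laplaceOrtho hb (n p) x * laplaceOrtho hb (n' p) x)
      ((hcont _).mul (hcont _)).aestronglyMeasurable
  simp_rw [this]
  split_ifs with h
  · simp [h]
  · obtain ⟨p, hp⟩ := Function.ne_iff.1 h
    exact Finset.prod_eq_zero (Finset.mem_univ p) (by simp [hp])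

lemma integrable_productOrtho_mul (n n' : I → ℕ) :
    Integrable (fun ω => productOrtho hb n (fun p => w p ω) * productOrtho hb n' (fun p => w p ω))
      P := by
  have := hind.isProbabilityMeasure
  have := isProbabilityMeasure_laplaceMeasure hb
  simp only [productOrtho, ← Finset.prod_mul_distrib]
  have h : Integrable (fun x : I → ℝ => ∏ p, (laplaceOrtho hb (n p) (x p) *
      laplaceOrtho hb (n' p) (x p))) (P.map fun ω p => w p ω) := by
    rw [hind.map_fun_eq_pi_map fun p => (hlaw p).aemeasurable]
    simp_rw [(hlaw _).map_eq]
    exact Integrable.fintype_prod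
      (f := fun p x => laplaceOrtho hb (n p) x * laplaceOrtho hb (n' p) x)
      fun p => integrable_laplaceOrtho_mul hb (n p) (n' p)
  exact h.comp_aemeasurable (aemeasurable_pi_lambda _ fun p => (hlaw p).aemeasurable)

lemma integral_sq_sum_productOrtho (s : Finset (I → ℕ)) (c : (I → ℕ) → ℝ) :
    Integrable (fun ω => (∑ n ∈ s, c n * productOrtho hb n fun p => w p ω) ^ 2) P ∧
    ∫ ω, (∑ n ∈ s, c n * productOrtho hb n fun p => w p ω) ^ 2 ∂P = ∑ n ∈ s, c n ^ 2 := by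
  have e : ∀ ω, (∑ n ∈ s, c n * productOrtho hb n fun p => w p ω) ^ 2 =
      ∑ n ∈ s, ∑ n' ∈ s, c n * c n' * (productOrtho hb n (fun p => w p ω) *
        productOrtho hb n' fun p => w p ω) := by
    intro ω
    rw [pow_two, Finset.sum_mul_sum]
    exact Finset.sum_congr rfl fun n _ => Finset.sum_congr rfl fun n' _ => by ring
  have hi := integrable_productOrtho_mul hb hlaw hind
  simp_rw [e]
  refine ⟨integrable_finsetSum _ fun n _ => integrable_finsetSum _ fun n' _ =>
    (hi n n').const_mul _, ?_⟩
  rw [integral_finsetSum _ fun n _ => integrable_finsetSum _ fun n' _ => (hi n n').const_mul _]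
  refine Finset.sum_congr rfl fun n hn => ?_
  rw [integral_finsetSum _ fun n' _ => (hi n n').const_mul _]
  simp_rw [integral_const_mul, integral_productOrtho_mul hb hlaw hind]
  simp [hn, pow_two]

/-- The bound for the second moment of a column of the `k`-th alternating power. -/
noncomputable def altPowBound (b : ℝ) (N k : ℕ) : ℝ :=
  (4 * b ^ 2) ^ k * ∏ m ∈ Finset.range k, ((N : ℝ) + (2 * (m : ℝ) + 2) ^ 2)

variable {R D : Type*} [Fintype R] [Fintype D]

omit hlaw hind

/-- The `j₀`-th columns of the alternating powers `(WᵀW) ^ k` and `W (WᵀW) ^ k`, expanded in the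
orthonormal products. -/
lemma exists_coeff_altPow [DecidableEq I] [DecidableEq D] {ix : R → D → I}
    (hix : Function.Injective2 ix) (j₀ : D) (k : ℕ) :
    (∃ c : (I → ℕ) → D → ℝ, (∀ n ∉ degLE I (2 * k), ∀ j, c n j = 0) ∧
      (∑ n ∈ degLE I (2 * k), ∑ j, c n j ^ 2 ≤
        altPowBound b (Fintype.card R + Fintype.card D) (2 * k)) ∧
      ∀ (w : I → ℝ) (j : D), (((Matrix.of fun i j => w (ix i j)).transpose *
        (Matrix.of fun i j => w (ix i j))) ^ k) j j₀ =
          ∑ n ∈ degLE I (2 * k), c n j * productOrtho hb n w) ∧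
    (∃ c : (I → ℕ) → R → ℝ, (∀ n ∉ degLE I (2 * k + 1), ∀ i, c n i = 0) ∧
      (∑ n ∈ degLE I (2 * k + 1), ∑ i, c n i ^ 2 ≤
        altPowBound b (Fintype.card R + Fintype.card D) (2 * k + 1)) ∧
      ∀ (w : I → ℝ) (i : R), ((Matrix.of fun i j => w (ix i j)) *
        ((Matrix.of fun i j => w (ix i j)).transpose *
          (Matrix.of fun i j => w (ix i j))) ^ k) i j₀ =
            ∑ n ∈ degLE I (2 * k + 1), c n i * productOrtho hb n w) := by
  have hα := coeffGrowth_laplaceCoeff hb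
  have hix' : Function.Injective2 fun j i => ix i j := fun _ _ _ _ h => (hix h).symm
  set N := Fintype.card R + Fintype.card D with hN
  have hstep : ∀ k (x : ℝ), x ≤ altPowBound b N k →
      4 * b ^ 2 * ((N : ℝ) + (2 * k + 2) ^ 2) * x ≤ altPowBound b N (k + 1) := by
    intro k x hx
    refine (mul_le_mul_of_nonneg_left hx (by positivity)).trans (le_of_eq ?_)
    rw [altPowBound, altPowBound, Finset.prod_range_succ, pow_succ]
    ring
  -- an even power, multiplied by the matrix, is the next odd power
  have hodd : ∀ k, (∃ c : (I → ℕ) → D → ℝ, (∀ n ∉ degLE I (2 * k), ∀ j, c n j = 0) ∧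
      (∑ n ∈ degLE I (2 * k), ∑ j, c n j ^ 2 ≤ altPowBound b N (2 * k)) ∧
      ∀ (w : I → ℝ) (j : D), (((Matrix.of fun i j => w (ix i j)).transpose *
        (Matrix.of fun i j => w (ix i j))) ^ k) j j₀ =
          ∑ n ∈ degLE I (2 * k), c n j * productOrtho hb n w) →
      (∃ c : (I → ℕ) → R → ℝ, (∀ n ∉ degLE I (2 * k + 1), ∀ i, c n i = 0) ∧
      (∑ n ∈ degLE I (2 * k + 1), ∑ i, c n i ^ 2 ≤ altPowBound b N (2 * k + 1)) ∧
      ∀ (w : I → ℝ) (i : R), ((Matrix.of fun i j => w (ix i j)) *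
        ((Matrix.of fun i j => w (ix i j)).transpose *
          (Matrix.of fun i j => w (ix i j))) ^ k) i j₀ =
            ∑ n ∈ degLE I (2 * k + 1), c n i * productOrtho hb n w) := by
    rintro k ⟨c, hc, hb2, hrep⟩
    obtain ⟨c', hc', hb', hrep'⟩ := hα.exists_mul_coeff hix (2 * k) hc
    refine ⟨c', hc', hb'.trans ?_, fun w i => ?_⟩
    · have := hstep (2 * k) _ hb2
      rw [hN] at this ⊢
      push_cast at this ⊢
      exact this
    · rw [← hrep' w (fun n => productOrtho hb n w) (fun p n => mul_productOrtho hb p n w) i,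
        Matrix.mul_apply]
      exact Finset.sum_congr rfl fun j _ => by rw [hrep w j]; rfl
  have heven : ∃ c : (I → ℕ) → D → ℝ, (∀ n ∉ degLE I (2 * k), ∀ j, c n j = 0) ∧
      (∑ n ∈ degLE I (2 * k), ∑ j, c n j ^ 2 ≤ altPowBound b N (2 * k)) ∧
      ∀ (w : I → ℝ) (j : D), (((Matrix.of fun i j => w (ix i j)).transpose *
        (Matrix.of fun i j => w (ix i j))) ^ k) j j₀ =
          ∑ n ∈ degLE I (2 * k), c n j * productOrtho hb n w := by
    induction k with
    | zero =>
      have h0 : degLE I 0 = {0} := by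
        ext n
        rw [mem_degLE, Finset.mem_singleton]
        constructor
        · intro h; ext p
          have := Finset.single_le_sum (f := n) (fun _ _ => Nat.zero_le _) (Finset.mem_univ p)
          simp only [Pi.zero_apply]; omega
        · rintro rfl; simp
      refine ⟨fun n j => if n = 0 ∧ j = j₀ then 1 else 0, ?_, ?_, ?_⟩
      · intro n hn j
        rw [mul_zero, h0, Finset.mem_singleton] at hn
        simp [hn]
      · simp [h0, altPowBound, Finset.filter_eq']
      · intro w j
        simp [h0, productOrtho, laplaceOrtho_zero, Matrix.one_apply]
    | succ k ih =>
      obtain ⟨c, hc, hb2, hrep⟩ := hodd k ih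
      obtain ⟨c', hc', hb', hrep'⟩ := hα.exists_mul_coeff hix' (2 * k + 1) hc
      refine ⟨c', hc', hb'.trans ?_, fun w j => ?_⟩
      · have := hstep (2 * k + 1) _ hb2
        rw [hN] at this ⊢
        push_cast at this ⊢
        rw [add_comm (Fintype.card D : ℝ)]
        exact this
      · rw [show 2 * (k + 1) = 2 * k + 1 + 1 by ring]
        rw [← hrep' w (fun n => productOrtho hb n w) (fun p n => mul_productOrtho hb p n w) j,
          pow_succ', Matrix.mul_assoc, Matrix.mul_apply]
        exact Finset.sum_congr rfl fun i _ => by rw [hrep w i]; rfl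
  exact ⟨heven, hodd k heven⟩

include hb hlaw hind

lemma integral_sum_sum_sq_le (s : Finset (I → ℕ)) (c : D → (I → ℕ) → R → ℝ) {B : ℝ}
    (hB : ∀ j₀, ∑ n ∈ s, ∑ j, c j₀ n j ^ 2 ≤ B) :
    Integrable (fun ω => ∑ j₀, ∑ j, (∑ n ∈ s, c j₀ n j *
      productOrtho hb n fun p => w p ω) ^ 2) P ∧
    ∫ ω, ∑ j₀, ∑ j, (∑ n ∈ s, c j₀ n j * productOrtho hb n fun p => w p ω) ^ 2 ∂P ≤
      Fintype.card D * B := by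
  have hi := fun j₀ j => integral_sq_sum_productOrtho hb hlaw hind (s)
    (fun n => c j₀ n j)
  have hi2 := fun j₀ => integrable_finsetSum Finset.univ fun j _ => (hi j₀ j).1
  refine ⟨integrable_finsetSum _ fun j₀ _ => hi2 j₀, ?_⟩
  rw [integral_finsetSum _ fun j₀ _ => hi2 j₀]
  calc _ = ∑ j₀, ∑ n ∈ s, ∑ j, c j₀ n j ^ 2 := by
        refine Finset.sum_congr rfl fun j₀ _ => ?_
        rw [integral_finsetSum _ fun j _ => (hi j₀ j).1, Finset.sum_comm]
        exact Finset.sum_congr rfl fun j _ => (hi j₀ j).2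
    _ ≤ ∑ _j₀ : D, B := Finset.sum_le_sum fun j₀ _ => hB j₀
    _ = _ := by simp

lemma integral_altPowSq_le [DecidableEq D] {ix : R → D → I} (hix : Function.Injective2 ix)
    (k : ℕ) :
    Integrable (fun ω => altPowSq (Matrix.of fun i j => w (ix i j) ω) k) P ∧
    ∫ ω, altPowSq (Matrix.of fun i j => w (ix i j) ω) k ∂P ≤
      Fintype.card D * altPowBound b (Fintype.card R + Fintype.card D) k := by
  classical
  rcases Nat.even_or_odd' k with ⟨m, rfl | rfl⟩
  · choose c _ hB hrep using fun j₀ => (exists_coeff_altPow hb hix j₀ m).1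
    have e : ∀ ω, altPowSq (Matrix.of fun i j => w (ix i j) ω) (2 * m) =
        ∑ j₀, ∑ j, (∑ n ∈ degLE I (2 * m), c j₀ n j * productOrtho hb n fun p => w p ω) ^ 2 := by
      intro ω
      rw [altPowSq, if_pos (even_two_mul m), Nat.mul_div_cancel_left m two_pos]
      exact Finset.sum_congr rfl fun j₀ _ => Finset.sum_congr rfl fun j _ => by
        rw [← hrep j₀ (fun p => w p ω) j]
    simp_rw [e]
    exact integral_sum_sum_sq_le hb hlaw hind _ c hB
  · choose c _ hB hrep using fun j₀ => (exists_coeff_altPow hb hix j₀ m).2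
    have e : ∀ ω, altPowSq (Matrix.of fun i j => w (ix i j) ω) (2 * m + 1) =
        ∑ j₀, ∑ i, (∑ n ∈ degLE I (2 * m + 1), c j₀ n i *
          productOrtho hb n fun p => w p ω) ^ 2 := by
      intro ω
      rw [altPowSq, if_neg (by simp), show (2 * m + 1) / 2 = m by omega]
      exact Finset.sum_congr rfl fun j₀ _ => Finset.sum_congr rfl fun i _ => by
        rw [← hrep j₀ (fun p => w p ω) i]
    simp_rw [e]
    exact integral_sum_sum_sq_le hb hlaw hind _ c hB

open scoped Matrix.Norms.L2Operator in
/-- The tail of the spectral norm, by Markov's inequality for `cosh (‖A‖ / (√8 b))`. -/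
lemma measure_l2_opNorm_gt_le [DecidableEq D] [Nonempty D] {ix : R → D → I}
    (hix : Function.Injective2 ix) (hcard : Fintype.card D ≤ Fintype.card R) {δ : ℝ} (hδ : 0 < δ)
    (hδ1 : δ < 1) :
    P {ω | √8 * b * (√(Fintype.card R) + √(Fintype.card D) + Real.log (2 / δ) + 1 / 2) <
      ‖(Matrix.of fun i j => w (ix i j) ω : Matrix R D ℝ)‖} ≤ ENNReal.ofReal δ := by
  set A : Ω → Matrix R D ℝ := fun ω => Matrix.of fun i j => w (ix i j) ω with hA
  set r : ℝ := (Fintype.card R : ℝ) with hr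
  set d : ℝ := (Fintype.card D : ℝ) with hd
  set T : ℝ := √r + √d + Real.log (2 / δ) + 1 / 2 with hT
  have hd1 : 1 ≤ d := by rw [hd]; exact_mod_cast Fintype.card_pos
  have hdr : d ≤ r := by rw [hd, hr]; exact_mod_cast hcard
  have hT0 : 0 ≤ T := by
    have : 0 ≤ Real.log (2 / δ) := Real.log_nonneg (by rw [le_div_iff₀ hδ]; linarith)
    positivity
  have h8 : √8 ^ 2 = (8 : ℝ) := Real.sq_sqrt (by norm_num)
  have hsb : 0 < √8 * b := by positivity
  have hmom := integral_altPowSq_le hb hlaw hind hix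
  let a : ℕ → ℝ := fun k => ((√8 * b) ^ (2 * k) * ((2 * k).factorial : ℝ))⁻¹
  have ha0 : ∀ k, 0 ≤ a k := fun k => by positivity
  let G : Ω → ℝ≥0∞ := fun ω => ∑' k, ENNReal.ofReal (a k * altPowSq (A ω) k)
  -- the expectation of the dominating series
  have hG : ∫⁻ ω, G ω ∂P ≤ ENNReal.ofReal (Real.exp (√r + √d + 1 / 2)) := by
    have hint : ∀ k, Integrable (fun ω => a k * altPowSq (A ω) k) P := fun k =>
      (hmom k).1.const_mul _
    rw [lintegral_tsum fun k => (hint k).aestronglyMeasurable.aemeasurable.ennreal_ofReal]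
    refine ENNReal.tsum_le_of_sum_range_le fun K => ?_
    have hk : ∀ k, ∫⁻ ω, ENNReal.ofReal (a k * altPowSq (A ω) k) ∂P ≤ ENNReal.ofReal (d *
        ((∏ m ∈ Finset.range k, ((r + d) + (2 * (m : ℝ) + 2) ^ 2)) /
          (2 ^ k * ((2 * k).factorial : ℝ)))) := by
      intro k
      rw [← ofReal_integral_eq_lintegral_ofReal (hint k) (Filter.Eventually.of_forall fun ω =>
        mul_nonneg (ha0 k) (altPowSq_nonneg _ _)), integral_const_mul]
      refine ENNReal.ofReal_le_ofReal
        ((mul_le_mul_of_nonneg_left (hmom k).2 (ha0 k)).trans (le_of_eq ?_))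
      simp only [a, altPowBound]
      rw [pow_mul, mul_pow, h8]
      have hfac : ((2 * k).factorial : ℝ) ≠ 0 := by positivity
      have e : (8 * b ^ 2) ^ k = 2 ^ k * (4 * b ^ 2) ^ k := by rw [← mul_pow]; ring
      have hb0 : (4 * b ^ 2) ^ k ≠ 0 := by positivity
      rw [e, hr, hd]
      push_cast
      field_simp
    refine (Finset.sum_le_sum fun k _ => hk k).trans ?_
    rw [← ENNReal.ofReal_sum_of_nonneg fun k _ => by positivity, ← Finset.mul_sum]
    refine ENNReal.ofReal_le_ofReal (le_trans ?_ (mul_cosh_le_exp hd1 hdr))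
    exact mul_le_mul_of_nonneg_left (sum_prod_div_factorial_le (by linarith) K) (by linarith)
  -- on the bad event the series is at least `cosh T`
  have hbad : {ω | √8 * b * T < ‖A ω‖} ⊆ {ω | ENNReal.ofReal (Real.cosh T) ≤ G ω} := by
    intro ω hω
    set y := ‖A ω‖ / (√8 * b) with hy
    have hTy : T < y := by rw [hy, lt_div_iff₀ hsb]; linarith [hω.out]
    have hcosh : Real.cosh T ≤ Real.cosh y := by
      rw [Real.cosh_le_cosh, abs_of_nonneg hT0, abs_of_nonneg (hT0.trans hTy.le)]
      exact hTy.le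
    have hser := Real.hasSum_cosh y
    have hy0 : 0 ≤ y := hT0.trans hTy.le
    refine (ENNReal.ofReal_le_ofReal hcosh).trans ?_
    rw [← hser.tsum_eq, ENNReal.ofReal_tsum_of_nonneg (fun k => by positivity) hser.summable]
    refine ENNReal.tsum_le_tsum fun k => ENNReal.ofReal_le_ofReal ?_
    calc y ^ (2 * k) / ((2 * k).factorial : ℝ) = a k * ‖A ω‖ ^ (2 * k) := by
          simp only [a, hy, div_pow]
          field_simp
      _ ≤ _ := mul_le_mul_of_nonneg_left (l2_opNorm_pow_le_altPowSq _ _) (ha0 k)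
  have hGm : AEMeasurable G P := AEMeasurable.tsum fun k =>
    ((hmom k).1.const_mul (a k)).aestronglyMeasurable.aemeasurable.ennreal_ofReal
  have hmarkov := mul_meas_ge_le_lintegral₀ hGm (ENNReal.ofReal (Real.cosh T))
  have hcT : Real.exp (√r + √d + 1 / 2) ≤ δ * Real.cosh T := by
    have h1 : Real.exp T = Real.exp (√r + √d + 1 / 2) * (2 / δ) := by
      rw [show T = √r + √d + 1 / 2 + Real.log (2 / δ) by rw [hT]; ring, Real.exp_add,
        Real.exp_log (by positivity)]
    have h2 : Real.exp T / 2 ≤ Real.cosh T := by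
      rw [Real.cosh_eq]; linarith [Real.exp_pos (-T)]
    calc Real.exp (√r + √d + 1 / 2) = δ * (Real.exp T / 2) := by rw [h1]; field_simp
      _ ≤ _ := mul_le_mul_of_nonneg_left h2 hδ.le
  have hfin : ENNReal.ofReal (Real.cosh T) * P {ω | √8 * b * T < ‖A ω‖} ≤
      ENNReal.ofReal (Real.cosh T) * ENNReal.ofReal δ := by
    calc _ ≤ ENNReal.ofReal (Real.cosh T) * P {ω | ENNReal.ofReal (Real.cosh T) ≤ G ω} :=
          mul_le_mul_right (measure_mono hbad) _
      _ ≤ ENNReal.ofReal (Real.exp (√r + √d + 1 / 2)) := hmarkov.trans hG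
      _ ≤ ENNReal.ofReal (Real.cosh T * δ) := ENNReal.ofReal_le_ofReal (by linarith)
      _ = _ := ENNReal.ofReal_mul (Real.cosh_pos T).le
  exact (ENNReal.mul_le_mul_iff_right (by simpa using Real.cosh_pos T) ENNReal.ofReal_ne_top).1 hfin

end RandomMatrix


/-! ### The isotropic Gaussian measure -/

theorem posSemidef_sq_smul_one (n : ℕ) (σ : ℝ) :
    (σ ^ 2 • (1 : Matrix (Fin n) (Fin n) ℝ)).PosSemidef :=
  Matrix.PosSemidef.one.smul (sq_nonneg σ)

instance isGaussian_isoGaussian (n : ℕ) (σ : ℝ) : IsGaussian (isoGaussian n σ) := by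
  unfold isoGaussian; infer_instance

theorem isoGaussian_eq_map_pi (n : ℕ) (σ : ℝ) :
    isoGaussian n σ =
      (Measure.pi fun _ => gaussianReal 0 (σ ^ 2).toNNReal).map (WithLp.toLp 2) := by
  apply Measure.ext_of_charFun (E := EuclideanSpace ℝ (Fin n))
  ext t
  rw [isoGaussian, charFun_multivariateGaussian (posSemidef_sq_smul_one n σ), charFun_pi]
  simp_rw [charFun_gaussianReal, ← Complex.exp_sum]
  congr 1
  simp only [inner_zero_right, Complex.ofReal_zero, zero_mul, Matrix.smul_mulVec,
    Matrix.one_mulVec, dotProduct_smul, Real.coe_toNNReal _ (sq_nonneg σ)]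
  simp [dotProduct, Finset.mul_sum, Finset.sum_div, pow_two]

theorem map_inner_isoGaussian {n : ℕ} (σ : ℝ) (h : EuclideanSpace ℝ (Fin n)) :
    (isoGaussian n σ).map (fun x => inner ℝ h x) = gaussianReal 0 (σ ^ 2 * ‖h‖ ^ 2).toNNReal := by
  have key := IsGaussian.map_eq_gaussianReal (μ := isoGaussian n σ) (innerSL ℝ h)
  have hmean : (isoGaussian n σ)[innerSL ℝ h] = 0 := by
    rw [(innerSL ℝ h).integral_comp_id_comm IsGaussian.integrable_id]
    simp [isoGaussian]
  have hvar : Var[innerSL ℝ h; isoGaussian n σ] = σ ^ 2 * ‖h‖ ^ 2 := by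
    change Var[fun x => inner ℝ h x; isoGaussian n σ] = _
    rw [← covariance_self (by fun_prop), ← covarianceBilin_apply_eq_cov IsGaussian.memLp_two_id,
      isoGaussian, covarianceBilin_multivariateGaussian (posSemidef_sq_smul_one n σ),
      EuclideanSpace.real_norm_sq_eq]
    simp only [Matrix.smul_mulVec, Matrix.one_mulVec, dotProduct, Pi.smul_apply, smul_eq_mul,
      Finset.mul_sum]
    exact Finset.sum_congr rfl fun i _ => by ring
  rw [hmean, hvar] at key
  exact key

/-! ### Translates of Gaussian measures -/

theorem gaussianReal_eq_withDensity (h : ℝ) {v : NNReal} (hv : v ≠ 0) :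
    gaussianReal h v = (gaussianReal 0 v).withDensity
      fun x => ENNReal.ofReal (Real.exp ((h * x - h ^ 2 / 2) / v)) := by
  rw [gaussianReal_of_var_ne_zero _ hv, gaussianReal_of_var_ne_zero _ hv,
    ← withDensity_mul _ (measurable_gaussianPDF _ _) (by fun_prop)]
  congr 1
  ext x
  rw [Pi.mul_apply, gaussianPDF, gaussianPDF, ← ENNReal.ofReal_mul (gaussianPDFReal_nonneg _ _ _),
    gaussianPDFReal, gaussianPDFReal, mul_assoc _ (Real.exp _), ← Real.exp_add]
  have hv' : (v : ℝ) ≠ 0 := by exact_mod_cast hv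
  congr 4
  field_simp
  ring

/-- Product measures and densities: the factors may be given densities one coordinate at a time. -/
theorem pi_withDensity {ι : Type*} [Fintype ι] (μ : ι → Measure ℝ)
    [∀ i, IsProbabilityMeasure (μ i)] (ρ : ι → ℝ → ℝ≥0∞) (hρ : ∀ i, Measurable (ρ i))
    [∀ i, SigmaFinite ((μ i).withDensity (ρ i))] :
    Measure.pi (fun i => (μ i).withDensity (ρ i)) =
      (Measure.pi μ).withDensity fun x => ∏ i, ρ i (x i) := by
  refine Measure.pi_eq fun s hs => ?_
  have hbox : MeasurableSet (Set.univ.pi s) := MeasurableSet.univ_pi hs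
  have hind : iIndepFun (fun i (x : ι → ℝ) => (s i).indicator (ρ i) (x i)) (Measure.pi μ) :=
    iIndepFun_pi fun i => ((hρ i).indicator (hs i)).aemeasurable
  rw [withDensity_apply _ hbox, ← lintegral_indicator hbox]
  have hprod : ∀ x : ι → ℝ, (Set.univ.pi s).indicator (fun x => ∏ i, ρ i (x i)) x =
      ∏ i, (s i).indicator (ρ i) (x i) := by
    intro x
    by_cases hx : x ∈ Set.univ.pi s
    · rw [Set.indicator_of_mem hx]
      exact Finset.prod_congr rfl fun i _ => (Set.indicator_of_mem (hx i trivial) _).symm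
    · rw [Set.indicator_of_notMem hx]
      obtain ⟨i, hi⟩ : ∃ i, x i ∉ s i := by simpa using hx
      exact (Finset.prod_eq_zero (Finset.mem_univ i) (Set.indicator_of_notMem hi _)).symm
  simp_rw [hprod]
  rw [lintegral_prod_eq_prod_lintegral_of_indepFun _ _ hind
    fun i => ((hρ i).indicator (hs i)).comp (measurable_pi_apply i)]
  refine Finset.prod_congr rfl fun i _ => ?_
  rw [withDensity_apply _ (hs i), ← lintegral_indicator (hs i),
    ← lintegral_map ((hρ i).indicator (hs i)) (measurable_pi_apply i),
    (measurePreserving_eval μ i).map_eq]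

/-- The Cameron-Martin formula for the isotropic Gaussian measure. -/
theorem isoGaussian_map_add_eq_withDensity {n : ℕ} {σ : ℝ} (hσ : 0 < σ ^ 2)
    (h : EuclideanSpace ℝ (Fin n)) :
    (isoGaussian n σ).map (fun x => h + x) = (isoGaussian n σ).withDensity
      fun x => ENNReal.ofReal (Real.exp ((inner ℝ h x - ‖h‖ ^ 2 / 2) / σ ^ 2)) := by
  set v : NNReal := (σ ^ 2).toNNReal with hv
  have hv0 : v ≠ 0 := (Real.toNNReal_pos.2 hσ).ne'
  have hvσ : (v : ℝ) = σ ^ 2 := Real.coe_toNNReal _ hσ.le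
  set G := Measure.pi fun _ : Fin n => gaussianReal 0 v with hG
  have hshift : G.map (fun x i => h i + x i) = G.withDensity
      fun x => ∏ i, ENNReal.ofReal (Real.exp ((h i * x i - h i ^ 2 / 2) / v)) := by
    have hfac : ∀ i, (gaussianReal 0 v).map (h i + ·) = (gaussianReal 0 v).withDensity
        fun x => ENNReal.ofReal (Real.exp ((h i * x - h i ^ 2 / 2) / v)) := fun i => by
      rw [gaussianReal_map_const_add, zero_add, gaussianReal_eq_withDensity _ hv0]
    have : ∀ i, IsProbabilityMeasure ((gaussianReal 0 v).map (h i + ·)) := fun i =>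
      Measure.isProbabilityMeasure_map (by fun_prop)
    have : ∀ i, SigmaFinite ((gaussianReal 0 v).withDensity
        fun x => ENNReal.ofReal (Real.exp ((h i * x - h i ^ 2 / 2) / v))) := fun i => by
      rw [← hfac i]; infer_instance
    rw [hG, Measure.pi_map_pi (f := fun i y => h i + y) fun i => by fun_prop]
    simp_rw [hfac]
    exact pi_withDensity _ _ fun i => by fun_prop
  ext S hS
  rw [isoGaussian_eq_map_pi, ← hG, Measure.map_map (by fun_prop) (by fun_prop),
    withDensity_apply _ hS, setLIntegral_map hS (by fun_prop) (by fun_prop),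
    ← withDensity_apply _ (hS.preimage (by fun_prop))]
  have hcomp : (fun x => h + x) ∘ WithLp.toLp 2 =
      WithLp.toLp 2 ∘ fun (x : Fin n → ℝ) i => h i + x i := by
    ext x i; simp
  rw [hcomp, ← Measure.map_map (by fun_prop) (by fun_prop), hshift,
    Measure.map_apply (by fun_prop) hS]
  congr 2
  ext x
  rw [← ENNReal.ofReal_prod_of_nonneg fun i _ => (Real.exp_pos _).le, ← Real.exp_sum,
    ← Finset.sum_div, Finset.sum_sub_distrib, ← Finset.sum_div, hvσ,
    EuclideanSpace.real_norm_sq_eq]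
  simp [PiLp.inner_apply, mul_comm]

/-- The Chernoff bound for a centred Gaussian variable, with the factor `1 / 2` that comes from
keeping only the positive half of the tilted variable. -/
theorem gaussianReal_Ioi_le {v : NNReal} (hv : v ≠ 0) {c : ℝ} (hc : 0 ≤ c) :
    gaussianReal 0 v (Set.Ioi c) ≤ ENNReal.ofReal (Real.exp (-(c ^ 2 / (2 * v))) / 2) := by
  have hv' : 0 < (v : ℝ) := by exact_mod_cast pos_iff_ne_zero.2 hv
  have hhalf : gaussianReal 0 v (Set.Ioi 0) ≤ ENNReal.ofReal (1 / 2) := by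
    have hneg : gaussianReal 0 v (Set.Iio 0) = gaussianReal 0 v (Set.Ioi 0) := by
      have := gaussianReal_map_neg (μ := 0) (v := v)
      rw [neg_zero] at this
      conv_lhs => rw [← this]
      rw [Measure.map_apply measurable_neg measurableSet_Iio]
      congr 1
      ext x; simp
    have hsum : gaussianReal 0 v (Set.Iio 0) + gaussianReal 0 v (Set.Ioi 0) ≤ 1 := by
      rw [← measure_union (by
        rw [Set.disjoint_left]
        exact fun x hx hx' => lt_asymm (Set.mem_Iio.1 hx) (Set.mem_Ioi.1 hx')) measurableSet_Ioi]
      exact prob_le_one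
    rw [hneg, ← two_mul] at hsum
    rw [ENNReal.ofReal_div_of_pos two_pos, ENNReal.ofReal_one, ENNReal.le_div_iff_mul_le (by simp)
      (by simp), mul_comm]
    simpa using hsum
  have hshift : gaussianReal 0 v (Set.Ioi c) = gaussianReal (-c) v (Set.Ioi 0) := by
    have := gaussianReal_map_const_add (μ := 0) (v := v) (-c)
    rw [zero_add] at this
    rw [← this, Measure.map_apply (by fun_prop) measurableSet_Ioi]
    congr 1
    ext x; simp
  rw [hshift, gaussianReal_eq_withDensity _ hv, withDensity_apply _ measurableSet_Ioi]
  calc ∫⁻ x in Set.Ioi 0, ENNReal.ofReal (Real.exp ((-c * x - (-c) ^ 2 / 2) / v))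
        ∂gaussianReal 0 v
      ≤ ∫⁻ _ in Set.Ioi 0, ENNReal.ofReal (Real.exp (-(c ^ 2 / (2 * v)))) ∂gaussianReal 0 v := by
        refine setLIntegral_mono measurable_const fun x hx => ?_
        refine ENNReal.ofReal_le_ofReal (Real.exp_le_exp.2 ?_)
        have hx0 : (0 : ℝ) < x := hx
        rw [show -(c ^ 2 / (2 * (v : ℝ))) = (-(c ^ 2) / 2) / v by field_simp]
        gcongr
        nlinarith
    _ = ENNReal.ofReal (Real.exp (-(c ^ 2 / (2 * v)))) * gaussianReal 0 v (Set.Ioi 0) := by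
        rw [setLIntegral_const]
    _ ≤ ENNReal.ofReal (Real.exp (-(c ^ 2 / (2 * v)))) * ENNReal.ofReal (1 / 2) := by gcongr
    _ = _ := by rw [← ENNReal.ofReal_mul (Real.exp_pos _).le, mul_one_div]

/-! ### The Gaussian mechanism -/

/-- If `ρ` is the density of one output distribution relative to another, then privacy can only
fail where `ρ` exceeds `c`. -/
theorem withDensity_apply_le_mul_add {α : Type*} [MeasurableSpace α] (μ : Measure α)
    {ρ : α → ℝ≥0∞} (hρ : Measurable ρ) (c : ℝ≥0∞) {S : Set α} (hS : MeasurableSet S) :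
    μ.withDensity ρ S ≤ c * μ S + μ.withDensity ρ {x | c < ρ x} := by
  have hbad : MeasurableSet {x | c < ρ x} := measurableSet_lt measurable_const hρ
  calc μ.withDensity ρ S
      ≤ μ.withDensity ρ (S \ {x | c < ρ x}) + μ.withDensity ρ {x | c < ρ x} :=
        (measure_mono (by intro x hx; by_cases h : c < ρ x <;> simp [hx, h])).trans
          (measure_union_le _ _)
    _ ≤ _ := by
        gcongr
        rw [withDensity_apply _ (hS.diff hbad)]
        calc ∫⁻ x in S \ {x | c < ρ x}, ρ x ∂μ ≤ ∫⁻ _ in S \ {x | c < ρ x}, c ∂μ :=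
              setLIntegral_mono measurable_const fun x hx => not_lt.1 hx.2
          _ = c * μ (S \ {x | c < ρ x}) := setLIntegral_const _ _
          _ ≤ c * μ S := by gcongr; exact Set.sdiff_subset

/-- Two translates of the isotropic Gaussian measure are indistinguishable up to `ε` and the tail
of the privacy loss, which is the probability that a centred Gaussian variable of variance
`σ² ‖h‖²` exceeds `ε σ² - ‖h‖² / 2`. -/
theorem isoGaussian_map_add_apply_le {n : ℕ} {σ ε : ℝ} (hσ : 0 < σ ^ 2)
    {h : EuclideanSpace ℝ (Fin n)} (hh : h ≠ 0) (hc : 0 ≤ ε * σ ^ 2 - ‖h‖ ^ 2 / 2)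
    {S : Set (EuclideanSpace ℝ (Fin n))} (hS : MeasurableSet S) :
    (isoGaussian n σ).map (fun x => h + x) S ≤
      ENNReal.ofReal (Real.exp ε) * isoGaussian n σ S +
        ENNReal.ofReal
          (Real.exp (-((ε * σ ^ 2 - ‖h‖ ^ 2 / 2) ^ 2 / (2 * (σ ^ 2 * ‖h‖ ^ 2)))) / 2) := by
  have hh' : 0 < ‖h‖ := norm_pos_iff.2 hh
  have hcm := isoGaussian_map_add_eq_withDensity hσ h
  have hdp := withDensity_apply_le_mul_add (isoGaussian n σ)
    (ρ := fun x => ENNReal.ofReal (Real.exp ((inner ℝ h x - ‖h‖ ^ 2 / 2) / σ ^ 2)))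
    (by fun_prop) (ENNReal.ofReal (Real.exp ε)) hS
  rw [← hcm] at hdp
  refine hdp.trans ?_
  gcongr
  have hv : (σ ^ 2 * ‖h‖ ^ 2).toNNReal ≠ 0 := by
    simpa using (by positivity : 0 < σ ^ 2 * ‖h‖ ^ 2)
  have htail := gaussianReal_Ioi_le hv hc
  rw [Real.coe_toNNReal _ (by positivity), ← map_inner_isoGaussian,
    Measure.map_apply (by fun_prop) measurableSet_Ioi] at htail
  refine le_trans (le_of_eq ?_) htail
  rw [Measure.map_apply (by fun_prop)
    (measurableSet_lt measurable_const (by fun_prop))]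
  congr 1
  ext x
  simp only [Set.mem_preimage, Set.mem_ofPred_eq, Set.mem_Ioi]
  rw [ENNReal.ofReal_lt_ofReal_iff (Real.exp_pos _), Real.exp_lt_exp, lt_div_iff₀ hσ,
    inner_add_right, real_inner_self_eq_norm_sq]
  constructor <;> intro hx <;> linarith

theorem encode_sub {r d : ℕ} (W : Matrix (Fin r) (Fin d) ℝ) (f f' : EuclideanSpace ℝ (Fin d)) :
    encode W (f - f') = encode W f - encode W f' := by
  simp [encode, Matrix.mulVec_sub]

theorem norm_encode_le {r d : ℕ} (W : Matrix (Fin r) (Fin d) ℝ) (f : EuclideanSpace ℝ (Fin d)) :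
    ‖encode W f‖ ≤ specNorm W * ‖f‖ :=
  (Matrix.toEuclideanLin W).toContinuousLinearMap.le_opNorm f

/-- The Gaussian mechanism is private as soon as the Gaussian tail of the privacy loss is at most
`δ` for every distance `Δ ≤ 2 C t` that two codes can have when the spectral norm is at most
`t`. -/
theorem featureDP_gaussianMechanism {r d : ℕ} {W : Matrix (Fin r) (Fin d) ℝ} {C ε δ σ t : ℝ}
    (hσ : 0 < σ ^ 2) (hε : 0 ≤ ε) (hW : specNorm W ≤ t)
    (htail : ∀ Δ : ℝ, 0 < Δ → Δ ≤ t * (2 * C) → 0 ≤ ε * σ ^ 2 - Δ ^ 2 / 2 ∧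
      Real.exp (-((ε * σ ^ 2 - Δ ^ 2 / 2) ^ 2 / (2 * (σ ^ 2 * Δ ^ 2)))) / 2 ≤ δ) :
    FeatureDP (Metric.closedBall (0 : EuclideanSpace ℝ (Fin d)) C) C ε δ
      (gaussianMechanism W σ) := by
  intro f _ f' _ hff S hS
  set h := encode W f - encode W f' with hh
  have hΔ : ‖h‖ ≤ t * (2 * C) := by
    rw [hh, ← encode_sub]
    refine (norm_encode_le W _).trans ?_
    have : 0 ≤ specNorm W := norm_nonneg _
    gcongr
    exact this.trans hW
  set T := (fun x => encode W f' + x) ⁻¹' S with hT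
  have hTm : MeasurableSet T := hS.preimage (by fun_prop)
  have hf' : gaussianMechanism W σ f' S = isoGaussian r σ T := by
    rw [gaussianMechanism, Measure.map_apply (by fun_prop) hS]
  have hf : gaussianMechanism W σ f S = (isoGaussian r σ).map (fun x => h + x) T := by
    rw [gaussianMechanism, Measure.map_apply (by fun_prop) hS,
      Measure.map_apply (by fun_prop) hTm]
    congr 1
    ext x
    have hx : encode W f' + (h + x) = encode W f + x := by rw [hh]; abel
    simp only [hT, Set.mem_preimage, hx]
  rw [hf, hf']
  by_cases h0 : h = 0
  · have : (1 : ℝ≥0∞) ≤ ENNReal.ofReal (Real.exp ε) := by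
      simpa using Real.one_le_exp hε
    simp only [h0, zero_add, Measure.map_id']
    exact le_add_right (le_mul_of_one_le_left' this)
  · obtain ⟨hc, hle⟩ := htail ‖h‖ (norm_pos_iff.2 h0) hΔ
    refine (isoGaussian_map_add_apply_le hσ h0 hc hTm).trans ?_
    gcongr

/-- A lower bound for the exponent in the tail of the privacy loss, with `s` for `σ²` and `q` for
`Δ²`.  Replacing `y` by `y + 1 / 2` costs at most `1` in the exponent because `ℓ ≤ y - 2`, and
the correction `q / 2` costs at most `ε / 2`. -/
theorem gaussian_exponent_ge {ε s ℓ y q : ℝ} (hε : 0 < ε) (hε1 : ε ≤ 1) (hs : 0 < s) (hq : 0 < q)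
    (hℓ : 1 / 2 ≤ ℓ) (hℓy : ℓ ≤ y - 2)
    (hle : 2 * y ^ 2 * ℓ * q ≤ s * ε ^ 2 * (y + 1 / 2) ^ 2) :
    0 ≤ ε * s - q / 2 ∧ ℓ - 3 / 2 ≤ (ε * s - q / 2) ^ 2 / (2 * (s * q)) := by
  have hy : 2 ≤ y := by linarith
  have hεs : s * ε ^ 2 ≤ s * ε := by
    have : ε ^ 2 ≤ ε := by nlinarith
    gcongr
  constructor
  · have h1 : y ^ 2 * q ≤ y ^ 2 * (25 / 16 * (s * ε)) := by
      calc y ^ 2 * q ≤ 2 * y ^ 2 * ℓ * q := by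
            have : 0 ≤ y ^ 2 * q := by positivity
            nlinarith
        _ ≤ s * ε ^ 2 * (y + 1 / 2) ^ 2 := hle
        _ ≤ s * ε * (5 / 4 * y) ^ 2 := by gcongr; linarith
        _ = y ^ 2 * (25 / 16 * (s * ε)) := by ring
    have h2 := le_of_mul_le_mul_left h1 (by positivity)
    have : 0 ≤ s * ε := by positivity
    linarith
  · have h1 : (2 * ℓ - 2) * q * (y + 1 / 2) ^ 2 ≤ s * ε ^ 2 * (y + 1 / 2) ^ 2 := by
      refine le_trans ?_ hle
      have : ℓ * (y + 1 / 4) ≤ (y + 1 / 2) ^ 2 := by nlinarith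
      nlinarith
    have h2 := le_of_mul_le_mul_right h1 (by positivity)
    rw [le_div_iff₀ (by positivity)]
    have h3 : s * ((2 * ℓ - 2) * q) ≤ s * (s * ε ^ 2) := by gcongr
    have h4 : ε * (s * q) ≤ 1 * (s * q) := by gcongr
    nlinarith [sq_nonneg q]


/-! ### The linear adversary -/

theorem integral_sq_affine_isoGaussian_prod {n : ℕ} (σ τ c s t : ℝ) (i : Fin n) :
    Integrable (fun p : EuclideanSpace ℝ (Fin n) × EuclideanSpace ℝ (Fin n) =>
      (c + (s * p.1 i + t * p.2 i)) ^ 2) ((isoGaussian n σ).prod (isoGaussian n τ)) ∧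
    ∫ p : EuclideanSpace ℝ (Fin n) × EuclideanSpace ℝ (Fin n),
      (c + (s * p.1 i + t * p.2 i)) ^ 2 ∂((isoGaussian n σ).prod (isoGaussian n τ)) =
      c ^ 2 + (s ^ 2 * σ ^ 2 + t ^ 2 * τ ^ 2) := by
  set Q := (isoGaussian n σ).prod (isoGaussian n τ) with hQ
  have heval : ∀ ρ : ℝ, MeasurePreserving (fun x : EuclideanSpace ℝ (Fin n) => x i)
      (isoGaussian n ρ) (gaussianReal 0 (ρ ^ 2).toNNReal) := fun ρ => by
    simpa [isoGaussian] using measurePreserving_eval_multivariateGaussian (μ := 0)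
      (posSemidef_sq_smul_one n ρ) (i := i)
  have h1 : MeasurePreserving
      (fun p : EuclideanSpace ℝ (Fin n) × EuclideanSpace ℝ (Fin n) => p.1 i) Q
      (gaussianReal 0 (σ ^ 2).toNNReal) := (heval σ).comp measurePreserving_fst
  have h2 : MeasurePreserving
      (fun p : EuclideanSpace ℝ (Fin n) × EuclideanSpace ℝ (Fin n) => p.2 i) Q
      (gaussianReal 0 (τ ^ 2).toNNReal) := (heval τ).comp measurePreserving_snd
  have hind : IndepFun (fun p : EuclideanSpace ℝ (Fin n) × EuclideanSpace ℝ (Fin n) => s * p.1 i)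
      (fun p => t * p.2 i) Q :=
    indepFun_prod (X := fun x : EuclideanSpace ℝ (Fin n) => s * x i)
      (Y := fun x : EuclideanSpace ℝ (Fin n) => t * x i) (by fun_prop) (by fun_prop)
  have hl1 : HasLaw (fun p : EuclideanSpace ℝ (Fin n) × EuclideanSpace ℝ (Fin n) => s * p.1 i)
      (gaussianReal (s * 0) (⟨s ^ 2, sq_nonneg s⟩ * (σ ^ 2).toNNReal)) Q :=
    gaussianReal_const_mul ⟨h1.measurable.aemeasurable, h1.map_eq⟩ s
  have hl2 : HasLaw (fun p : EuclideanSpace ℝ (Fin n) × EuclideanSpace ℝ (Fin n) => t * p.2 i)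
      (gaussianReal (t * 0) (⟨t ^ 2, sq_nonneg t⟩ * (τ ^ 2).toNNReal)) Q :=
    gaussianReal_const_mul ⟨h2.measurable.aemeasurable, h2.map_eq⟩ t
  have hsum := gaussianReal_add_gaussianReal_of_indepFun hind hl1.map_eq hl2.map_eq
  have hl := gaussianReal_const_add (X := (fun p : EuclideanSpace ℝ (Fin n) ×
    EuclideanSpace ℝ (Fin n) => s * p.1 i) + fun p => t * p.2 i) ⟨by fun_prop, hsum⟩ c
  set v : NNReal := ⟨s ^ 2, sq_nonneg s⟩ * (σ ^ 2).toNNReal +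
    ⟨t ^ 2, sq_nonneg t⟩ * (τ ^ 2).toNNReal
  simp only [mul_zero, add_zero, zero_add, Pi.add_apply] at hl
  have hint : Integrable (fun x : ℝ => x ^ 2) (gaussianReal c v) :=
    (memLp_id_gaussianReal 2).integrable_sq
  have hval : ∫ x, x ^ 2 ∂gaussianReal c v = c ^ 2 + v := by
    have := variance_eq_sub (memLp_id_gaussianReal (μ := c) (v := v) 2)
    simp only [variance_id_gaussianReal, Pi.pow_apply, id, integral_id_gaussianReal] at this
    linarith
  have hvr : (v : ℝ) = s ^ 2 * σ ^ 2 + t ^ 2 * τ ^ 2 := by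
    change s ^ 2 * ((σ ^ 2).toNNReal : ℝ) + t ^ 2 * ((τ ^ 2).toNNReal : ℝ) = _
    rw [Real.coe_toNNReal _ (sq_nonneg σ), Real.coe_toNNReal _ (sq_nonneg τ)]
  constructor
  · have := hl.map_eq ▸ hint
    exact this.comp_aemeasurable hl.aemeasurable
  · rw [← hvr, ← hval, ← hl.map_eq, integral_map hl.aemeasurable (by fun_prop)]

/-- The bias-variance decomposition of the error of a linear estimator. -/
theorem advMSE_eq (r : ℕ) (g α σ σa γ : ℝ) (z : EuclideanSpace ℝ (Fin r)) :
    advMSE r g α σ σa γ z = ENNReal.ofReal ((γ * (g * α) - 1) ^ 2 * ‖z‖ ^ 2 +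
      γ ^ 2 * (r * (g ^ 2 * α ^ 2 * σ ^ 2 + σa ^ 2))) := by
  have hpt : ∀ p : EuclideanSpace ℝ (Fin r) × EuclideanSpace ℝ (Fin r),
      ‖γ • advObservation g α z p.1 p.2 - z‖ ^ 2 =
        ∑ i, ((γ * (g * α) - 1) * z i + (γ * (g * α) * p.1 i + γ * p.2 i)) ^ 2 := by
    intro p
    rw [EuclideanSpace.real_norm_sq_eq]
    refine Finset.sum_congr rfl fun i _ => ?_
    simp only [advObservation, PiLp.sub_apply, PiLp.smul_apply, PiLp.add_apply, smul_eq_mul]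
    ring
  have hmom := fun i => integral_sq_affine_isoGaussian_prod (n := r) σ σa
    ((γ * (g * α) - 1) * z i) (γ * (g * α)) γ i
  rw [advMSE]
  simp_rw [hpt]
  rw [← ofReal_integral_eq_lintegral_ofReal
    (integrable_finsetSum _ fun i _ => (hmom i).1)
    (Filter.Eventually.of_forall fun p => Finset.sum_nonneg fun i _ => sq_nonneg _),
    integral_finsetSum _ fun i _ => (hmom i).1]
  simp_rw [fun i => (hmom i).2]
  congr 1
  rw [Finset.sum_add_distrib, EuclideanSpace.real_norm_sq_eq, Finset.mul_sum]
  congr 1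
  · exact Finset.sum_congr rfl fun i _ => by ring
  · simp only [Finset.sum_const, Finset.card_univ, Fintype.card_fin, nsmul_eq_mul]
    ring

/-- For codes on the sphere of radius `D` the error is a quadratic polynomial in the scale `γ` of
the estimator, and its minimum bounds the minimax error from below. -/
theorem le_minimaxAdvMSE {r : ℕ} (hr : 0 < r) (g α σ σa : ℝ) {D : ℝ} (hD : 0 ≤ D) :
    ENNReal.ofReal (r * (g ^ 2 * α ^ 2 * σ ^ 2 + σa ^ 2) * D ^ 2 /
      (g ^ 2 * α ^ 2 * D ^ 2 + r * (g ^ 2 * α ^ 2 * σ ^ 2 + σa ^ 2))) ≤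
      minimaxAdvMSE r g α σ σa D := by
  refine le_iInf fun γ => ?_
  set z : EuclideanSpace ℝ (Fin r) := EuclideanSpace.single ⟨0, hr⟩ D with hz
  have hzn : ‖z‖ = D := by simp [hz, abs_of_nonneg hD]
  refine le_trans ?_ (le_iSup₂ (f := fun z (_ : z ∈ Metric.closedBall _ D) =>
    advMSE r g α σ σa γ z) z (by simp [hzn]))
  rw [advMSE_eq, hzn]
  refine ENNReal.ofReal_le_ofReal ?_
  set N : ℝ := r * (g ^ 2 * α ^ 2 * σ ^ 2 + σa ^ 2) with hN
  have hN0 : 0 ≤ N := by positivity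
  refine div_le_of_le_mul₀ (by positivity) (by positivity) ?_
  -- The difference of the two sides is the square that vanishes at the optimal scale.
  have hsq := sq_nonneg (γ * (N + g ^ 2 * α ^ 2 * D ^ 2) - g * α * D ^ 2)
  nlinarith [hsq]


/-! ### The spectral norm event and its consequences -/

open scoped Matrix.Norms.L2Operator in
theorem specNorm_eq_l2_opNorm {r d : ℕ} (W : Matrix (Fin r) (Fin d) ℝ) : specNorm W = ‖W‖ := by
  rw [Matrix.l2_opNorm_def]
  rfl

open scoped Matrix.Norms.L2Operator in
/-- The tail bound for the spectral norm of a Laplace matrix, in either orientation. -/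
theorem measure_specNorm_gt_le {Ω : Type*} [MeasurableSpace Ω] {P : Measure Ω}
    [IsProbabilityMeasure P] {r d : ℕ} (hr : 0 < r) (hd : 0 < d) {b δ : ℝ} (hb : 0 < b)
    (hδ : 0 < δ) (hδ1 : δ < 1) {W : Ω → Matrix (Fin r) (Fin d) ℝ}
    (hlaw : ∀ i j, HasLaw (fun ω => W ω i j) (laplaceMeasure 0 b) P)
    (hind : iIndepFun (fun (p : Fin r × Fin d) ω => W ω p.1 p.2) P) :
    P {ω | √8 * b * (√r + √d + Real.log (2 / δ) + 1 / 2) < specNorm (W ω)} ≤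
      ENNReal.ofReal δ := by
  have : Nonempty (Fin r) := ⟨⟨0, hr⟩⟩
  have : Nonempty (Fin d) := ⟨⟨0, hd⟩⟩
  have hlaw' : ∀ p : Fin r × Fin d, HasLaw (fun ω => W ω p.1 p.2) (laplaceMeasure 0 b) P :=
    fun p => hlaw p.1 p.2
  simp_rw [specNorm_eq_l2_opNorm]
  rcases le_total d r with h | h
  · have := measure_l2_opNorm_gt_le hb hlaw' hind (R := Fin r) (D := Fin d)
      (ix := fun i j => (i, j)) (fun _ _ _ _ hij => by simpa using hij) (by simpa using h) hδ hδ1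
    simp only [Fintype.card_fin] at this
    exact this
  · have := measure_l2_opNorm_gt_le hb hlaw' hind (R := Fin d) (D := Fin r)
      (ix := fun j i => (i, j)) (fun _ _ _ _ hij => by simpa [and_comm] using hij)
      (by simpa using h) hδ hδ1
    have htr : ∀ ω, ‖(Matrix.of fun j i => W ω i j : Matrix (Fin d) (Fin r) ℝ)‖ = ‖W ω‖ := by
      intro ω
      rw [← Matrix.l2_opNorm_conjTranspose (W ω)]
      rfl
    simp only [Fintype.card_fin, htr] at this
    rwa [add_comm √(r : ℝ)]

/-- The privacy guarantee on the event that the spectral norm is at most `√8 b (y + 1 / 2)`, where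
`y = √r + √d + log (2 / δ)`. -/
theorem featureDP_of_specNorm_le {r d : ℕ} (hr : 0 < r) (hd : 0 < d) {b C ε δ Cw σ : ℝ}
    (hb : 0 < b) (hC : 0 < C) (hε : 0 < ε) (hε1 : ε ≤ 1) (hδ : 0 < δ)
    (hCw : Cw = 4 * (1 + Real.log (2 / δ) / (√(r : ℝ) + √(d : ℝ))))
    (hσ : σ ^ 2 =
      8 * Cw ^ 2 * b ^ 2 * C ^ 2 * ((r : ℝ) + (d : ℝ)) * Real.log (1.25 / δ) / ε ^ 2)
    {W : Matrix (Fin r) (Fin d) ℝ}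
    (hW : specNorm W ≤ √8 * b * (√r + √d + Real.log (2 / δ) + 1 / 2)) :
    FeatureDP (Metric.closedBall (0 : EuclideanSpace ℝ (Fin d)) C) C ε (2 * δ)
      (gaussianMechanism W σ) := by
  rcases le_or_gt (1 / 2) δ with hδ2 | hδ2
  · -- A failure probability of at least `1` asks for nothing.
    intro f _ f' _ _ S _
    have : IsProbabilityMeasure (gaussianMechanism W σ f) :=
      Measure.isProbabilityMeasure_map (by fun_prop)
    refine prob_le_one.trans (le_add_left ?_)
    simpa using ENNReal.ofReal_le_ofReal (by linarith : 1 ≤ 2 * δ)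
  have hr1 : 1 ≤ √(r : ℝ) := Real.one_le_sqrt.2 (by exact_mod_cast hr)
  have hd1 : 1 ≤ √(d : ℝ) := Real.one_le_sqrt.2 (by exact_mod_cast hd)
  set s := √(r : ℝ) + √(d : ℝ) with hs
  set y := s + Real.log (2 / δ) with hy
  set ℓ := Real.log (1.25 / δ) with hℓ
  have hs2 : s ^ 2 ≤ 2 * ((r : ℝ) + d) := by
    nlinarith [sq_nonneg (√(r : ℝ) - √(d : ℝ)), Real.sq_sqrt (Nat.cast_nonneg (α := ℝ) r),
      Real.sq_sqrt (Nat.cast_nonneg (α := ℝ) d)]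
  have hCws : Cw * s = 4 * y := by
    have hs0 : s ≠ 0 := by linarith
    rw [hCw, hy]; field_simp
  have hℓ1 : 1 / 2 ≤ ℓ := by
    have h2 : Real.log 2 ≤ ℓ := Real.log_le_log (by norm_num) (by
      rw [le_div_iff₀ hδ]; linarith)
    linarith [Real.log_two_gt_d9]
  have hℓy : ℓ ≤ y - 2 := by
    have : ℓ ≤ Real.log (2 / δ) := Real.log_le_log (by positivity) (by gcongr; norm_num)
    linarith
  have hy2 : 0 < y := by linarith
  have hσε : σ ^ 2 * ε ^ 2 = 8 * Cw ^ 2 * b ^ 2 * C ^ 2 * ((r : ℝ) + d) * ℓ := by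
    rw [hσ]; field_simp
  have hσlow : 64 * y ^ 2 * b ^ 2 * C ^ 2 * ℓ ≤ σ ^ 2 * ε ^ 2 := by
    have hsq : 16 * y ^ 2 = Cw ^ 2 * s ^ 2 := by rw [← mul_pow, hCws]; ring
    calc 64 * y ^ 2 * b ^ 2 * C ^ 2 * ℓ = 4 * Cw ^ 2 * b ^ 2 * C ^ 2 * s ^ 2 * ℓ := by
          linear_combination (4 * b ^ 2 * C ^ 2 * ℓ) * hsq
      _ ≤ 4 * Cw ^ 2 * b ^ 2 * C ^ 2 * (2 * ((r : ℝ) + d)) * ℓ := by gcongr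
      _ = σ ^ 2 * ε ^ 2 := by rw [hσε]; ring
  have hσ0 : 0 < σ ^ 2 := by
    have : 0 < σ ^ 2 * ε ^ 2 := lt_of_lt_of_le (by positivity) hσlow
    exact pos_of_mul_pos_left this (by positivity)
  refine featureDP_gaussianMechanism hσ0 hε.le hW fun Δ hΔ hΔle => ?_
  have hΔ2 : Δ ^ 2 ≤ 32 * C ^ 2 * b ^ 2 * (y + 1 / 2) ^ 2 := by
    calc Δ ^ 2 ≤ (√8 * b * (y + 1 / 2) * (2 * C)) ^ 2 := by gcongr
      _ = √8 ^ 2 * (4 * C ^ 2 * b ^ 2 * (y + 1 / 2) ^ 2) := by ring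
      _ = _ := by rw [Real.sq_sqrt (by norm_num)]; ring
  obtain ⟨hnn, hexp⟩ := gaussian_exponent_ge hε hε1 hσ0 (pow_pos hΔ 2) hℓ1 hℓy (by
    calc 2 * y ^ 2 * ℓ * Δ ^ 2 ≤ 2 * y ^ 2 * ℓ * (32 * C ^ 2 * b ^ 2 * (y + 1 / 2) ^ 2) := by
          gcongr
      _ = 64 * y ^ 2 * b ^ 2 * C ^ 2 * ℓ * (y + 1 / 2) ^ 2 := by ring
      _ ≤ _ := by gcongr)
  refine ⟨hnn, ?_⟩
  -- The tail is at most `exp (3 / 2) * δ / 2.5`, and `exp (3 / 2) ≤ 5`.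
  have he : Real.exp (3 / 2) ≤ 5 := by
    have h3 : Real.exp (3 / 2) ^ 2 = Real.exp 1 ^ 3 := by
      rw [← Real.exp_nat_mul, ← Real.exp_nat_mul]; norm_num
    have h4 : Real.exp 1 ^ 3 ≤ 2.7182818286 ^ 3 := by
      gcongr; exact Real.exp_one_lt_d9.le
    refine le_of_sq_le_sq ?_ (by norm_num)
    rw [h3]
    exact h4.trans (by norm_num)
  have hexpℓ : Real.exp (-ℓ) = δ / 1.25 := by
    rw [Real.exp_neg, hℓ, Real.exp_log (by positivity), inv_div]
  calc Real.exp (-((ε * σ ^ 2 - Δ ^ 2 / 2) ^ 2 / (2 * (σ ^ 2 * Δ ^ 2)))) / 2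
      ≤ Real.exp (3 / 2 + -ℓ) / 2 := by gcongr; linarith
    _ = Real.exp (3 / 2) * (δ / 1.25) / 2 := by rw [Real.exp_add, hexpℓ]
    _ ≤ 5 * (δ / 1.25) / 2 := by gcongr
    _ = 2 * δ := by ring

end FeaturePrivacy

theorem mainTheorem1 {Ω : Type*} [MeasurableSpace Ω] (P : Measure Ω) [IsProbabilityMeasure P]
    (r d : ℕ) (hr : 0 < r) (hd : 0 < d)
    (b Cf ε δ : ℝ) (hb : 0 < b) (hCf : 0 < Cf) (hε : 0 < ε) (hδ : 0 < δ) (hδ1 : δ < 1)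
    (W : Ω → Matrix (Fin r) (Fin d) ℝ)
    (hWlaw : ∀ i j, HasLaw (fun ω => W ω i j) (FeaturePrivacy.laplaceMeasure 0 b) P)
    (hWindep : iIndepFun (fun (p : Fin r × Fin d) ω => W ω p.1 p.2) P)
    (Cw σ D : ℝ)
    (hCw : Cw = 4 * (1 + Real.log (2 / δ) / (√(r : ℝ) + √(d : ℝ))))
    (hσ : σ ^ 2 =
      8 * Cw ^ 2 * b ^ 2 * Cf ^ 2 * ((r : ℝ) + (d : ℝ)) * Real.log (1.25 / δ) / ε ^ 2)
    (hD : D = Cf * Cw * b * (√(r : ℝ) + √(d : ℝ)))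
    (g α σa ν : ℝ) (hα : 0 < α) (hσa : 0 ≤ σa)
    (hν : ν ^ 2 = g ^ 2 * α ^ 2 * σ ^ 2 + σa ^ 2) :
    (∃ A : Set Ω, MeasurableSet A ∧ ENNReal.ofReal (1 - δ) ≤ P A ∧ ∀ ω ∈ A,
      FeaturePrivacy.specNorm (W ω) ≤ Cw * b * (√(r : ℝ) + √(d : ℝ)) ∧
      (∀ f ∈ Metric.closedBall (0 : EuclideanSpace ℝ (Fin d)) Cf,
        ‖FeaturePrivacy.encode (W ω) f‖ ≤ D) ∧
      (ε ≤ 1 → FeaturePrivacy.FeatureDP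
        (Metric.closedBall (0 : EuclideanSpace ℝ (Fin d)) Cf) Cf ε (2 * δ)
        (FeaturePrivacy.gaussianMechanism (W ω) σ))) ∧
    ENNReal.ofReal (r * ν ^ 2 * D ^ 2 / (g ^ 2 * α ^ 2 * D ^ 2 + r * ν ^ 2)) ≤
      FeaturePrivacy.minimaxAdvMSE r g α σ σa D := by
  have hr1 : 1 ≤ √(r : ℝ) := Real.one_le_sqrt.2 (by exact_mod_cast hr)
  have hd1 : 1 ≤ √(d : ℝ) := Real.one_le_sqrt.2 (by exact_mod_cast hd)
  have hlog : 0 ≤ Real.log (2 / δ) := Real.log_nonneg (by rw [le_div_iff₀ hδ]; linarith)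
  have hCw0 : 0 ≤ Cw := by rw [hCw]; positivity
  have hCws : Cw * (√(r : ℝ) + √(d : ℝ)) = 4 * (√r + √d + Real.log (2 / δ)) := by
    rw [hCw]; field_simp
  refine ⟨?_, ?_⟩
  · set bad : Set Ω := {ω | √8 * b * (√(r : ℝ) + √(d : ℝ) + Real.log (2 / δ) + 1 / 2) <
      FeaturePrivacy.specNorm (W ω)} with hbad
    -- The entries are only almost everywhere measurable, so `bad` need not be a measurable set.
    refine ⟨(toMeasurable P bad)ᶜ, (measurableSet_toMeasurable _ _).compl, ?_, fun ω hω => ?_⟩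
    · rw [prob_compl_eq_one_sub (measurableSet_toMeasurable _ _), measure_toMeasurable,
        ENNReal.ofReal_sub _ hδ.le, ENNReal.ofReal_one]
      exact tsub_le_tsub_left
        (FeaturePrivacy.measure_specNorm_gt_le hr hd hb hδ hδ1 hWlaw hWindep) _
    · have hW : FeaturePrivacy.specNorm (W ω) ≤
          √8 * b * (√(r : ℝ) + √(d : ℝ) + Real.log (2 / δ) + 1 / 2) :=
        not_lt.1 fun h => hω (subset_toMeasurable _ _ h)
      have hspec : FeaturePrivacy.specNorm (W ω) ≤ Cw * b * (√(r : ℝ) + √(d : ℝ)) := by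
        have h8 : √8 ≤ 3 := by
          rw [Real.sqrt_le_left (by norm_num)]; norm_num
        calc FeaturePrivacy.specNorm (W ω)
            ≤ √8 * b * (√(r : ℝ) + √(d : ℝ) + Real.log (2 / δ) + 1 / 2) := hW
          _ ≤ 3 * b * (√(r : ℝ) + √(d : ℝ) + Real.log (2 / δ) + 1 / 2) := by gcongr
          _ ≤ b * (4 * (√(r : ℝ) + √(d : ℝ) + Real.log (2 / δ))) := by
              rw [mul_comm 3 b, mul_assoc]
              refine mul_le_mul_of_nonneg_left ?_ hb.le
              linarith
          _ = Cw * b * (√(r : ℝ) + √(d : ℝ)) := by rw [← hCws]; ring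
      refine ⟨hspec, fun f hf => ?_, fun hε1 => ?_⟩
      · have hfn : ‖f‖ ≤ Cf := by simpa using hf
        calc ‖FeaturePrivacy.encode (W ω) f‖
            ≤ FeaturePrivacy.specNorm (W ω) * ‖f‖ := FeaturePrivacy.norm_encode_le _ _
          _ ≤ Cw * b * (√(r : ℝ) + √(d : ℝ)) * Cf := by gcongr
          _ = D := by rw [hD]; ring
      · exact FeaturePrivacy.featureDP_of_specNorm_le hr hd hb hCf hε hε1 hδ hCw hσ hW
  · rw [hν]
    exact FeaturePrivacy.le_minimaxAdvMSE hr g α σ σa (by rw [hD]; positivity)
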